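/- Theorem 1. Let $k\ge 1$ and let $b,c\ge 0$ be integers with $b+c>0$. Consider the Bagchi–Pal urn: an urn with white and blue balls which starts with $W_0$ white and $B_0$ blue balls and has replacement matrix $$\begin{pmatrix} k-b & b\\ c & k-c\end{pmatrix},$$ that is, after a white ball is picked and put back, $k-b$ white and $b$ blue balls are added, and after a blue ball is picked and put back, $c$ white and $k-c$ blue balls are added (a negative entry means that balls are removed). Assume that the urn is tenable: along every sequence of picks that is possible from $(W_0,B_0)$, the urn is never empty and no replacement makes a number of balls negative; in particular $\tau_0:=W_0+B_0\ge 1$. Embed the urn in continuous time as follows: the balls in the urn carry independent clocks, each ringing after an $\mathrm{Exp}(1)$ time; when the clock of a ball rings, this ball is picked and the replacement rule is executed instantaneously, and the process starts afresh from the new state, with independent $\mathrm{Exp}(1)$ clocks on all balls, independent of the past. Let $W(t)$ and $B(t)$ be the numbers of white and blue balls at time $t\ge 0$. Then for all integers $i,j\ge 0$ the mixed moments $\mathbb{E}[W^i(t)B^j(t)]$ are finite for every $t \ge 0$, and $$\lim_{t\to\infty}\frac{\mathbb{E}\bigl[W^i(t)B^j(t)\bigr]}{e^{k(i+j)t}}=\frac{b^j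 c^i}{(b+c)^{i+j}}\,k^{i+j}\left\langle\frac{\tau_0}{k}\right\rangle_{i+j},$$ where $\langle x\rangle_n=x(x+1)\cdots(x+n-1)$ is the rising factorial ($\langle x\rangle_0=1$, and $0^0=1$). Moreover, as $t\to\infty$, $$e^{-kt}\begin{pmatrix}W(t)\\ B(t)\end{pmatrix}\xrightarrow{\ d\ } G\begin{pmatrix}\frac{c}{b+c}\\[2pt] \frac{b}{b+c}\end{pmatrix},$$ where $G$ has the gamma distribution with shape $\tau_0/k$ and scale $k$ (mean $\tau_0$). -/

import Mathlib

open MeasureTheory ProbabilityTheory Filter Topology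

/-! Two-colour Polya urns and their continuous-time embedding (Polya processes).

A state `s = (w, β) : ℤ × ℤ` records the numbers of white and blue balls. Row `0` (row `1`) of a
replacement matrix `R` holds the numbers of white and blue balls added to the urn (removed, if
negative) after a white (blue) ball has been picked and put back. -/

namespace PolyaUrn

/-- The urn after the rule for a white pick has been executed. -/
def pickWhite (R : Matrix (Fin 2) (Fin 2) ℤ) (s : ℤ × ℤ) : ℤ × ℤ :=
  (s.1 + R 0 0, s.2 + R 0 1)

/-- The urn after the rule for a blue pick has been executed. -/
def pickBlue (R : Matrix (Fin 2) (Fin 2) ℤ) (s : ℤ × ℤ) : ℤ × ℤ :=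
  (s.1 + R 1 0, s.2 + R 1 1)

/-- The states that can be reached from `s₀` along some sequence of picks, where a ball of a
colour can be picked only if the urn holds one. -/
inductive Reachable (R : Matrix (Fin 2) (Fin 2) ℤ) (s₀ : ℤ × ℤ) : ℤ × ℤ → Prop
  | start : Reachable R s₀ s₀
  | white {s : ℤ × ℤ} : Reachable R s₀ s → 0 < s.1 → Reachable R s₀ (pickWhite R s)
  | blue {s : ℤ × ℤ} : Reachable R s₀ s → 0 < s.2 → Reachable R s₀ (pickBlue R s)

/-- The urn started from `s₀` is tenable: on every path of picks the replacement rule can always be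
executed (no negative number of balls arises) and there is always a ball left to pick. -/
def Tenable (R : Matrix (Fin 2) (Fin 2) ℤ) (s₀ : ℤ × ℤ) : Prop :=
  ∀ s, Reachable R s₀ s → 0 ≤ s.1 ∧ 0 ≤ s.2 ∧ 0 < s.1 + s.2

/-! In the state `(w, β)` the balls are numbered `0, …, w + β - 1`, the first `w` of them being the
white ones. Ball `m` carries a clock that rings after time `x m`. The first clock to ring determines
the ball that is picked. Since exponential clocks have no memory, the process starts afresh at every
ring: between the `n`-th and the `(n + 1)`-st ring, the remaining times on the clocks of the balls
in the urn are independent `Exp(1)` times, written `x n 0, x n 1, …`, independent of the past. -/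

/-- The time until the first clock rings in the state `s`. -/
noncomputable def waitingTime (s : ℤ × ℤ) (x : ℕ → ℝ) : ℝ :=
  ⨅ m : Fin (s.1 + s.2).toNat, x m

open Classical in
/-- The state after the first ring in the state `s`: the rule for white is executed if the clock
that rings first belongs to a white ball, the rule for blue otherwise. -/
noncomputable def step (R : Matrix (Fin 2) (Fin 2) ℤ) (s : ℤ × ℤ) (x : ℕ → ℝ) : ℤ × ℤ :=
  if ∃ m < s.1.toNat, x m = waitingTime s x then pickWhite R s else pickBlue R s

/-- The state of the urn immediately after the `n`-th ring. -/
noncomputable def urn (R : Matrix (Fin 2) (Fin 2) ℤ) (s₀ : ℤ × ℤ) (x : ℕ → ℕ → ℝ) : ℕ → ℤ × ℤ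
  | 0 => s₀
  | n + 1 => step R (urn R s₀ x n) (x n)

/-- The time of the `n`-th ring (with time `0` for `n = 0`). -/
noncomputable def ringTime (R : Matrix (Fin 2) (Fin 2) ℤ) (s₀ : ℤ × ℤ) (x : ℕ → ℕ → ℝ) (n : ℕ) : ℝ :=
  ∑ l ∈ Finset.range n, waitingTime (urn R s₀ x l) (x l)

/-- The number of rings up to and including time `t`. -/
noncomputable def ringCount (R : Matrix (Fin 2) (Fin 2) ℤ) (s₀ : ℤ × ℤ) (x : ℕ → ℕ → ℝ) (t : ℝ) : ℕ :=
  sSup {n : ℕ | ringTime R s₀ x n ≤ t}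

/-- `W(t)`, the number of white balls in the urn at time `t`. -/
noncomputable def white (R : Matrix (Fin 2) (Fin 2) ℤ) (s₀ : ℤ × ℤ) (x : ℕ → ℕ → ℝ) (t : ℝ) : ℤ :=
  (urn R s₀ x (ringCount R s₀ x t)).1

/-- `B(t)`, the number of blue balls in the urn at time `t`. -/
noncomputable def blue (R : Matrix (Fin 2) (Fin 2) ℤ) (s₀ : ℤ × ℤ) (x : ℕ → ℕ → ℝ) (t : ℝ) : ℤ :=
  (urn R s₀ x (ringCount R s₀ x t)).2

/-- The replacement matrix of the Bagchi-Pal urn with balance factor `k`. -/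
def bagchiPal (k b c : ℕ) : Matrix (Fin 2) (Fin 2) ℤ :=
  !![(k : ℤ) - b, (b : ℤ); (c : ℤ), (k : ℤ) - c]

end PolyaUrn

/-!
The proof rests on the balance of the urn: every ring adds `k` balls, so the total number of balls
after `n` rings is `τ₀ + k n`, whatever colours were drawn. Since the minimum of independent `Exp(1)`
times is independent of the place where it is attained, the sequence of ring times is independent of
the sequence of colours. Decomposing at the first ring shows by induction on `n` that
`E[g(S_n); n rings up to time t] = E[g(S_n)] * yuleProb k (τ₀ / k) t n`, where `S_n` is the
discrete-time urn and `yuleProb` is a negative binomial weight (`lintegral_ringEvent_indicator`).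
This separates the problem into two parts.

*Colours in discrete time.* The imbalance `Y = b w - c β` is an eigenfunction of the drift with
eigenvalue `k - b - c ≤ k - 1`, whence `E[Y(S_n)²] = o(n²)`. So the proportion of white balls tends
to `c / (b + c)` in mean square, and the expectation of `w ^ i * β ^ j` divided by
`(τ₀ + k n) ^ (i + j)` tends to `c ^ i * b ^ j / (b + c) ^ (i + j)`
(`tendsto_transition_iterate_imbalance_sq`, `tendsto_transition_iterate_monomial`).

*Size in continuous time.* With `r = τ₀ / k`, size-biasing the weights by the rising factorial
`⟨r + n⟩_p` gives `⟨r⟩_p * exp (k p t)` times the weights with parameter `r + p`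
(`yuleProb_mul_ascPochhammer`). Since these sum to one and each of them vanishes as `t → ∞`, moments
in continuous time follow from the asymptotics in discrete time by averaging
(`tendsto_tsum_yuleProb_mul_div_exp`). The negative binomial law is a mixture of Poisson laws over
the gamma law of shape `r` and scale `k` (`integral_poisson_gammaMeasure`). This yields the total
mass one and the convergence of the characteristic functions of the rescaled size to that of the
gamma law (`tendsto_tsum_yuleProb_mul_cexp`).

The limit in distribution of the pair follows from Lévy's continuity theorem for the total and
Slutsky's theorem, as the rescaled imbalance vanishes in `L²`.
-/

namespace PolyaUrn

/-! ### The transition operator of a balanced urn -/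

/-- Every replacement adds `k` balls in total. -/
def Balanced (R : Matrix (Fin 2) (Fin 2) ℤ) (k : ℕ) : Prop :=
  R 0 0 + R 0 1 = k ∧ R 1 0 + R 1 1 = k

/-- The transition operator of the discrete-time urn: `transition R g s` is the expectation of `g`
after one uniform draw from the urn in the state `s`. -/
noncomputable def transition (R : Matrix (Fin 2) (Fin 2) ℤ) (g : ℤ × ℤ → ℝ) (s : ℤ × ℤ) : ℝ :=
  (s.1 * g (pickWhite R s) + s.2 * g (pickBlue R s)) / (s.1 + s.2)

variable {R : Matrix (Fin 2) (Fin 2) ℤ} {s : ℤ × ℤ} {k : ℕ}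

theorem balanced_bagchiPal (k b c : ℕ) : Balanced (bagchiPal k b c) k := by
  constructor <;> simp [bagchiPal]

theorem Balanced.pickWhite_total (hR : Balanced R k) (s : ℤ × ℤ) :
    (pickWhite R s).1 + (pickWhite R s).2 = s.1 + s.2 + k := by
  have := hR.1
  simp only [pickWhite]
  linarith

theorem Balanced.pickBlue_total (hR : Balanced R k) (s : ℤ × ℤ) :
    (pickBlue R s).1 + (pickBlue R s).2 = s.1 + s.2 + k := by
  have := hR.2
  simp only [pickBlue]
  linarith

theorem Reachable.trans {s₁ s₂ s₃ : ℤ × ℤ} (h₁ : Reachable R s₁ s₂) (h₂ : Reachable R s₂ s₃) :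
    Reachable R s₁ s₃ := by
  induction h₂ with
  | start => exact h₁
  | white _ hs ih => exact ih.white hs
  | blue _ hs ih => exact ih.blue hs

theorem Tenable.white (h : Tenable R s) (hs : 0 < s.1) : Tenable R (pickWhite R s) :=
  fun _ h' => h _ ((Reachable.start.white hs).trans h')

theorem Tenable.blue (h : Tenable R s) (hs : 0 < s.2) : Tenable R (pickBlue R s) :=
  fun _ h' => h _ ((Reachable.start.blue hs).trans h')

theorem Tenable.white_nonneg (h : Tenable R s) : 0 ≤ s.1 := (h s .start).1

theorem Tenable.blue_nonneg (h : Tenable R s) : 0 ≤ s.2 := (h s .start).2.1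

theorem Tenable.total_pos (h : Tenable R s) : 0 < s.1 + s.2 := (h s .start).2.2

theorem transition_mono (hs : Tenable R s) {g h : ℤ × ℤ → ℝ}
    (hw : 0 < s.1 → g (pickWhite R s) ≤ h (pickWhite R s))
    (hb : 0 < s.2 → g (pickBlue R s) ≤ h (pickBlue R s)) :
    transition R g s ≤ transition R h s := by
  have h0 : (0 : ℝ) < s.1 + s.2 := by exact_mod_cast hs.total_pos
  unfold transition
  gcongr ?_ / _
  refine add_le_add ?_ ?_
  · rcases hs.white_nonneg.eq_or_lt with h1 | h1
    · simp [← h1]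
    · exact mul_le_mul_of_nonneg_left (hw h1) (by exact_mod_cast h1.le)
  · rcases hs.blue_nonneg.eq_or_lt with h1 | h1
    · simp [← h1]
    · exact mul_le_mul_of_nonneg_left (hb h1) (by exact_mod_cast h1.le)

/-- After `n` draws the urn is in a tenable state with `k * n` additional balls, so only the values
at such states matter for the `n`-step expectation. -/
theorem transition_iterate_mono (hR : Balanced R k) (n : ℕ) (hs : Tenable R s) {g h : ℤ × ℤ → ℝ}
    (H : ∀ s', Tenable R s' → s'.1 + s'.2 = s.1 + s.2 + k * n → g s' ≤ h s') :
    (transition R)^[n] g s ≤ (transition R)^[n] h s := by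
  induction n generalizing s with
  | zero => simpa using H s hs (by simp)
  | succ n ih =>
    rw [Function.iterate_succ_apply', Function.iterate_succ_apply']
    refine transition_mono hs (fun h1 => ih (hs.white h1) fun s' h2 h3 => H s' h2 ?_)
      (fun h1 => ih (hs.blue h1) fun s' h2 h3 => H s' h2 ?_)
    · rw [h3, hR.pickWhite_total]; push_cast; ring
    · rw [h3, hR.pickBlue_total]; push_cast; ring

theorem transition_iterate_affine (n : ℕ) (hs : Tenable R s) (g : ℤ × ℤ → ℝ) (x y : ℝ) :
    (transition R)^[n] (fun s' => x + y * g s') s = x + y * (transition R)^[n] g s := by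
  induction n generalizing s with
  | zero => simp
  | succ n ih =>
    have h0 : (0 : ℝ) < s.1 + s.2 := by exact_mod_cast hs.total_pos
    rw [Function.iterate_succ_apply', Function.iterate_succ_apply']
    have hw : (s.1 : ℝ) * (transition R)^[n] (fun s' => x + y * g s') (pickWhite R s) =
        s.1 * (x + y * (transition R)^[n] g (pickWhite R s)) := by
      rcases hs.white_nonneg.eq_or_lt with h1 | h1
      · simp [← h1]
      · rw [ih (hs.white h1)]
    have hb : (s.2 : ℝ) * (transition R)^[n] (fun s' => x + y * g s') (pickBlue R s) =
        s.2 * (x + y * (transition R)^[n] g (pickBlue R s)) := by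
      rcases hs.blue_nonneg.eq_or_lt with h1 | h1
      · simp [← h1]
      · rw [ih (hs.blue h1)]
    rw [transition, hw, hb, transition]
    field_simp
    ring

theorem transition_iterate_nonneg (hR : Balanced R k) (n : ℕ) (hs : Tenable R s) {g : ℤ × ℤ → ℝ}
    (H : ∀ s', Tenable R s' → 0 ≤ g s') : 0 ≤ (transition R)^[n] g s := by
  have h1 := transition_iterate_affine n hs g 0 0
  simp only [zero_mul, add_zero] at h1
  rw [← h1]
  exact transition_iterate_mono hR n hs fun s' h _ => H s' h

/-! ### Colour proportions in the discrete-time urn -/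

/-- A nonnegative sequence that is contracted by factors `1 - u n` with divergent `∑ u n`, up to
perturbations that are negligible compared with `u n`, tends to zero. -/
theorem tendsto_zero_of_contraction {a u v : ℕ → ℝ} (ha : ∀ n, 0 ≤ a n) (hu0 : ∀ n, 0 ≤ u n)
    (hu1 : ∀ n, u n ≤ 1) (hu : ¬ Summable u) (hv : Tendsto v atTop (𝓝 0))
    (h : ∀ n, a (n + 1) ≤ (1 - u n) * a n + u n * v n) : Tendsto a atTop (𝓝 0) := by
  rw [Metric.tendsto_atTop]
  intro ε hε
  obtain ⟨N, hN⟩ := Metric.tendsto_atTop.1 hv (ε / 2) (by positivity)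
  have key : ∀ m, a (N + m) ≤ ε / 2 + a N * Real.exp (-∑ l ∈ Finset.range m, u (N + l)) := by
    intro m
    induction m with
    | zero => simp; linarith
    | succ m ih =>
      have h1 := h (N + m)
      have h2 : v (N + m) ≤ ε / 2 := by
        have := hN (N + m) (by omega)
        rw [Real.dist_eq, sub_zero] at this
        exact (le_abs_self _).trans this.le
      have h3 : 1 - u (N + m) ≤ Real.exp (-u (N + m)) := by
        have := Real.add_one_le_exp (-u (N + m)); linarith
      rw [Finset.sum_range_succ, neg_add, Real.exp_add]
      have h4 := hu0 (N + m)
      have h5 := hu1 (N + m)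
      set q := a N * Real.exp (-∑ l ∈ Finset.range m, u (N + l))
      have hq : 0 ≤ q := mul_nonneg (ha N) (Real.exp_pos _).le
      calc a (N + (m + 1)) ≤ (1 - u (N + m)) * a (N + m) + u (N + m) * v (N + m) := h1
        _ ≤ (1 - u (N + m)) * (ε / 2 + q) + u (N + m) * (ε / 2) := by gcongr
        _ = ε / 2 + q * (1 - u (N + m)) := by ring
        _ ≤ ε / 2 + q * Real.exp (-u (N + m)) := by gcongr
        _ = _ := by simp only [q]; ring
  have hsum : Tendsto (fun m => ∑ l ∈ Finset.range m, u (N + l)) atTop atTop := by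
    rw [← not_summable_iff_tendsto_nat_atTop_of_nonneg fun l => hu0 _]
    intro h'
    apply hu
    rw [← summable_nat_add_iff N]
    simpa [add_comm] using h'
  have hlim : Tendsto (fun m => a N * Real.exp (-∑ l ∈ Finset.range m, u (N + l))) atTop (𝓝 0) := by
    simpa using (Real.tendsto_exp_neg_atTop_nhds_zero.comp hsum).const_mul (a N)
  obtain ⟨M, hM⟩ := (hlim.eventually_lt_const (half_pos hε)).exists_forall_of_atTop
  refine ⟨N + M, fun n hn => ?_⟩
  obtain ⟨m, rfl⟩ := Nat.exists_eq_add_of_le (show N ≤ n by omega)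
  have := key m
  have := hM m (by omega)
  rw [Real.dist_eq, sub_zero, abs_of_nonneg (ha _)]
  linarith

/-- The linear functional `b w - c β` of the state `(w, β)`. Its drift is proportional to itself,
with the factor given by the second eigenvalue `k - b - c` of the replacement matrix. -/
def imbalance (b c : ℕ) (s : ℤ × ℤ) : ℝ := b * s.1 - c * s.2

theorem transition_imbalance_sq_le {b c : ℕ} (hbc : 0 < b + c)
    (hs : Tenable (bagchiPal k b c) s) :
    transition (bagchiPal k b c) (fun s' => imbalance b c s' ^ 2) s ≤
      ((k : ℝ) - b - c) ^ 2 * (b ^ 2 + c ^ 2) +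
        (1 + 2 * ((k : ℝ) - 1) / (s.1 + s.2)) * imbalance b c s ^ 2 := by
  have h0 : (0 : ℝ) < s.1 + s.2 := by exact_mod_cast hs.total_pos
  have hw : (0 : ℝ) ≤ s.1 := by exact_mod_cast hs.white_nonneg
  have hb : (0 : ℝ) ≤ s.2 := by exact_mod_cast hs.blue_nonneg
  have hbc' : (1 : ℝ) ≤ b + c := by exact_mod_cast hbc
  have h1 : transition (bagchiPal k b c) (fun s' => imbalance b c s' ^ 2) s =
      (((k : ℝ) - b - c) ^ 2 * (b ^ 2 * s.1 + c ^ 2 * s.2) +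
        (s.1 + s.2 + 2 * ((k : ℝ) - b - c)) * imbalance b c s ^ 2) / (s.1 + s.2) := by
    simp only [transition, imbalance, pickWhite, pickBlue, bagchiPal, Matrix.of_apply,
      Matrix.cons_val', Matrix.cons_val_zero, Matrix.cons_val_one, Matrix.cons_val_fin_one]
    push_cast
    congr 1
    ring
  rw [h1, div_le_iff₀ h0]
  have h2 : (((k : ℝ) - b - c) ^ 2 * (b ^ 2 + c ^ 2) +
        (1 + 2 * ((k : ℝ) - 1) / (s.1 + s.2)) * imbalance b c s ^ 2) * (s.1 + s.2) =
      ((k : ℝ) - b - c) ^ 2 * ((b ^ 2 + c ^ 2) * (s.1 + s.2)) +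
        (s.1 + s.2 + 2 * ((k : ℝ) - 1)) * imbalance b c s ^ 2 := by
    field_simp
  rw [h2]
  gcongr ?_ * ?_ + ?_ * _
  · nlinarith [mul_nonneg (sq_nonneg (b : ℝ)) hb, mul_nonneg (sq_nonneg (c : ℝ)) hw]
  · linarith

theorem tendsto_inv_linear (x y : ℝ) (hy : 0 < y) :
    Tendsto (fun n : ℕ => 1 / (x + y * n)) atTop (𝓝 0) := by
  simp only [one_div]
  exact tendsto_inv_atTop_zero.comp
    (tendsto_atTop_add_const_left _ _ (tendsto_natCast_atTop_atTop.const_mul_atTop hy))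

/-- Relative to the squared number of balls, the second moment of the imbalance after `n` draws
vanishes. -/
theorem tendsto_transition_iterate_imbalance_sq {b c : ℕ} (hk : 0 < k) (hbc : 0 < b + c)
    (hs : Tenable (bagchiPal k b c) s) :
    Tendsto (fun n : ℕ => (transition (bagchiPal k b c))^[n] (fun s' => imbalance b c s' ^ 2) s /
      (s.1 + s.2 + k * n : ℝ) ^ 2) atTop (𝓝 0) := by
  have h0 : (1 : ℝ) ≤ s.1 + s.2 := by exact_mod_cast hs.total_pos
  have hk' : (1 : ℝ) ≤ k := by exact_mod_cast hk
  set τ : ℕ → ℝ := fun n => s.1 + s.2 + k * n with hτ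
  set C : ℝ := ((k : ℝ) - b - c) ^ 2 * (b ^ 2 + c ^ 2)
  set E : ℕ → ℝ := fun n => (transition (bagchiPal k b c))^[n] (fun s' => imbalance b c s' ^ 2) s
  have hτ1 : ∀ n, 1 ≤ τ n := fun n => by simp only [hτ]; nlinarith [Nat.cast_nonneg (α := ℝ) n]
  have hτs : ∀ n, τ (n + 1) = τ n + k := fun n => by simp only [hτ]; push_cast; ring
  have hE0 : ∀ n, 0 ≤ E n := fun n =>
    transition_iterate_nonneg (balanced_bagchiPal k b c) n hs fun _ _ => sq_nonneg _
  have hE : ∀ n, E (n + 1) ≤ C + (1 + 2 * ((k : ℝ) - 1) / τ n) * E n := by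
    intro n
    rw [← transition_iterate_affine n hs]
    simp only [E]
    rw [Function.iterate_succ_apply]
    refine transition_iterate_mono (balanced_bagchiPal k b c) n hs fun s' h1 h2 => ?_
    have h3 : (s'.1 + s'.2 : ℝ) = τ n := by simp only [hτ]; exact_mod_cast h2
    have := transition_imbalance_sq_le hbc h1
    rwa [h3] at this
  refine tendsto_zero_of_contraction (u := fun n => 1 / τ (n + 1)) (v := fun n => C * (1 / τ (n + 1)))
    (fun n => div_nonneg (hE0 n) (by positivity)) (fun n => ?_) (fun n => ?_) ?_ ?_ fun n => ?_
  · have := hτ1 (n + 1); positivity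
  · exact div_le_one_of_le₀ (hτ1 _) (by linarith [hτ1 (n + 1)])
  · intro hsum
    have h1 : Summable fun n : ℕ => 1 / ((n + 1 : ℕ) : ℝ) := by
      refine Summable.of_nonneg_of_le (fun n => by positivity) (fun n => ?_)
        (hsum.mul_left (s.1 + s.2 + k : ℝ))
      have h2 := hτ1 (n + 1)
      rw [mul_one_div, div_le_div_iff₀ (by positivity) (by linarith)]
      simp only [hτ]
      push_cast
      nlinarith [Nat.cast_nonneg (α := ℝ) n]
    exact Real.not_summable_one_div_natCast ((summable_nat_add_iff 1).1 h1)
  · have := ((tendsto_inv_linear (s.1 + s.2) k (by linarith)).comp (tendsto_add_atTop_nat 1)).const_mul C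
    simpa [hτ] using this
  · have h1 := hτ1 n
    have h2 := hE n
    have h3 := hE0 n
    change E (n + 1) / τ (n + 1) ^ 2 ≤ (1 - 1 / τ (n + 1)) * (E n / τ n ^ 2) +
      1 / τ (n + 1) * (C * (1 / τ (n + 1)))
    rw [hτs]
    have e1 : (1 - 1 / (τ n + k)) * (E n / τ n ^ 2) + 1 / (τ n + k) * (C * (1 / (τ n + k))) =
      (C + (τ n + k - 1) * (τ n + k) / τ n ^ 2 * E n) / (τ n + k) ^ 2 := by
      field_simp
      ring
    rw [e1]
    gcongr
    refine h2.trans ?_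
    gcongr
    rw [le_div_iff₀ (by positivity)]
    have e2 : (1 + 2 * ((k : ℝ) - 1) / τ n) * τ n ^ 2 = τ n ^ 2 + 2 * (k - 1) * τ n := by
      field_simp
    rw [e2]
    nlinarith

theorem abs_mul_pow_sub_le {x y x₀ y₀ : ℝ} (hx : |x| ≤ 1) (hy : |y| ≤ 1) (hx₀ : |x₀| ≤ 1)
    (hy₀ : |y₀| ≤ 1) (i j : ℕ) :
    |x ^ i * y ^ j - x₀ ^ i * y₀ ^ j| ≤ i * |x - x₀| + j * |y - y₀| := by
  have key : ∀ (u v : ℝ), |u| ≤ 1 → |v| ≤ 1 → ∀ n : ℕ, |u ^ n - v ^ n| ≤ n * |u - v| := by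
    intro u v hu hv n
    refine (abs_pow_sub_pow_le u v n).trans ?_
    have : max |u| |v| ^ (n - 1) ≤ 1 :=
      pow_le_one₀ (le_max_of_le_left (abs_nonneg _)) (max_le hu hv)
    calc |u - v| * n * max |u| |v| ^ (n - 1) ≤ |u - v| * n * 1 := by gcongr
      _ = _ := by ring
  have h1 : x ^ i * y ^ j - x₀ ^ i * y₀ ^ j = (x ^ i - x₀ ^ i) * y ^ j + x₀ ^ i * (y ^ j - y₀ ^ j) := by
    ring
  rw [h1]
  refine (abs_add_le _ _).trans (add_le_add ?_ ?_)
  · rw [abs_mul, abs_pow y]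
    exact (mul_le_of_le_one_right (abs_nonneg _) (pow_le_one₀ (abs_nonneg _) hy)).trans
      (key x x₀ hx hx₀ i)
  · rw [abs_mul, abs_pow x₀]
    exact (mul_le_of_le_one_left (abs_nonneg _) (pow_le_one₀ (abs_nonneg _) hx₀)).trans
      (key y y₀ hy hy₀ j)

/-- The colour proportions `w / τ` and `β / τ` converge in mean square to `c / (b + c)` and
`b / (b + c)`, hence so do the expectations of monomials in them. -/
theorem tendsto_transition_iterate_monomial {b c : ℕ} (hk : 0 < k) (hbc : 0 < b + c)
    (hs : Tenable (bagchiPal k b c) s) (i j : ℕ) :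
    Tendsto (fun n : ℕ => (transition (bagchiPal k b c))^[n]
      (fun s' => |(s'.1 : ℝ) ^ i * (s'.2 : ℝ) ^ j|) s / (s.1 + s.2 + k * n : ℝ) ^ (i + j)) atTop
      (𝓝 ((b : ℝ) ^ j * (c : ℝ) ^ i / ((b : ℝ) + c) ^ (i + j))) := by
  have h0 : (1 : ℝ) ≤ s.1 + s.2 := by exact_mod_cast hs.total_pos
  have hbc' : (1 : ℝ) ≤ b + c := by exact_mod_cast hbc
  set L : ℝ := (b : ℝ) ^ j * (c : ℝ) ^ i / ((b : ℝ) + c) ^ (i + j) with hL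
  set E : ℕ → ℝ := fun n => (transition (bagchiPal k b c))^[n] (fun s' => imbalance b c s' ^ 2) s
  set F : ℕ → ℝ := fun n => (transition (bagchiPal k b c))^[n]
      (fun s' => |(s'.1 : ℝ) ^ i * (s'.2 : ℝ) ^ j|) s
  have hlim := tendsto_transition_iterate_imbalance_sq hk hbc hs
  set D : ℝ := ((i : ℝ) + j) / (b + c)
  have hD : 0 ≤ D := by positivity
  -- `|m| ≤ δ + m² / δ` turns a Lipschitz bound into a bound by second moments
  have key : ∀ δ : ℝ, 0 < δ → ∀ n : ℕ,
      |F n / (s.1 + s.2 + k * n : ℝ) ^ (i + j) - L| ≤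
        D * (δ + E n / (s.1 + s.2 + k * n : ℝ) ^ 2 / δ) := by
    intro δ hδ n
    set τ : ℝ := s.1 + s.2 + k * n with hτ
    have hτ0 : 0 < τ := by positivity
    have pt : ∀ s', Tenable (bagchiPal k b c) s' → s'.1 + s'.2 = s.1 + s.2 + k * n →
        |(|(s'.1 : ℝ) ^ i * (s'.2 : ℝ) ^ j|) - L * τ ^ (i + j)| ≤
          τ ^ (i + j) * (D * (δ + imbalance b c s' ^ 2 / τ ^ 2 / δ)) := by
      intro s' h1 h2
      have h3 : (s'.1 + s'.2 : ℝ) = τ := by rw [hτ]; exact_mod_cast h2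
      have hw : (0 : ℝ) ≤ s'.1 := by exact_mod_cast h1.white_nonneg
      have hb : (0 : ℝ) ≤ s'.2 := by exact_mod_cast h1.blue_nonneg
      rw [abs_of_nonneg (show (0 : ℝ) ≤ (s'.1 : ℝ) ^ i * (s'.2 : ℝ) ^ j by positivity)]
      have e1 : (s'.1 : ℝ) ^ i * (s'.2 : ℝ) ^ j - L * τ ^ (i + j) = τ ^ (i + j) *
          ((s'.1 / τ) ^ i * (s'.2 / τ) ^ j - (c / (b + c) : ℝ) ^ i * (b / (b + c)) ^ j) := by
        rw [hL]
        simp only [div_pow, pow_add]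
        field_simp
      rw [e1, abs_mul, abs_of_pos (pow_pos hτ0 _)]
      gcongr
      have hM1 : (s'.1 / τ : ℝ) - c / (b + c) = imbalance b c s' / τ / (b + c) := by
        rw [imbalance]
        field_simp
        rw [← h3]
        ring
      have hM2 : (s'.2 / τ : ℝ) - b / (b + c) = -(imbalance b c s' / τ / (b + c)) := by
        rw [imbalance]
        field_simp
        rw [← h3]
        ring
      refine (abs_mul_pow_sub_le ?_ ?_ ?_ ?_ i j).trans ?_
      · rw [abs_of_nonneg (by positivity)]
        exact div_le_one_of_le₀ (by linarith) hτ0.le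
      · rw [abs_of_nonneg (by positivity)]
        exact div_le_one_of_le₀ (by linarith) hτ0.le
      · rw [abs_of_nonneg (by positivity)]
        exact div_le_one_of_le₀ (by linarith [Nat.cast_nonneg (α := ℝ) b]) (by linarith)
      · rw [abs_of_nonneg (by positivity)]
        exact div_le_one_of_le₀ (by linarith [Nat.cast_nonneg (α := ℝ) c]) (by linarith)
      · rw [hM1, hM2, abs_neg, abs_div, abs_of_pos (show (0 : ℝ) < b + c by linarith)]
        have e2 : (i : ℝ) * (|imbalance b c s' / τ| / (b + c)) +
            j * (|imbalance b c s' / τ| / (b + c)) = D * |imbalance b c s' / τ| := by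
          simp only [D]; ring
        rw [e2, ← div_pow]
        gcongr
        set m := imbalance b c s' / τ
        rw [← sq_abs, ← sub_nonneg]
        have : δ + |m| ^ 2 / δ - |m| = ((δ - |m|) ^ 2 + δ * |m|) / δ := by field_simp; ring
        rw [this]
        positivity
    have aff : ∀ σ : ℝ, (transition (bagchiPal k b c))^[n] (fun s' => L * τ ^ (i + j) +
          σ * (τ ^ (i + j) * (D * (δ + imbalance b c s' ^ 2 / τ ^ 2 / δ)))) s =
        τ ^ (i + j) * (L + σ * (D * (δ + E n / τ ^ 2 / δ))) := by
      intro σ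
      have h1 := transition_iterate_affine n hs (fun s' => imbalance b c s' ^ 2)
        (L * τ ^ (i + j) + σ * (τ ^ (i + j) * (D * δ))) (σ * (τ ^ (i + j) * (D * (1 / τ ^ 2 / δ))))
      calc _ = (transition (bagchiPal k b c))^[n] (fun s' =>
              L * τ ^ (i + j) + σ * (τ ^ (i + j) * (D * δ)) +
                σ * (τ ^ (i + j) * (D * (1 / τ ^ 2 / δ))) * imbalance b c s' ^ 2) s := by
            refine congrArg (fun G => (transition (bagchiPal k b c))^[n] G s) (funext fun s' => ?_)
            ring
        _ = _ := by rw [h1]; simp only [E]; ring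
    have up : F n ≤ τ ^ (i + j) * (L + 1 * (D * (δ + E n / τ ^ 2 / δ))) := by
      rw [← aff 1]
      refine transition_iterate_mono (balanced_bagchiPal k b c) n hs fun s' h1 h2 => ?_
      have := (abs_le.1 (pt s' h1 h2)).2
      linarith
    have lo : τ ^ (i + j) * (L + -1 * (D * (δ + E n / τ ^ 2 / δ))) ≤ F n := by
      rw [← aff (-1)]
      refine transition_iterate_mono (balanced_bagchiPal k b c) n hs fun s' h1 h2 => ?_
      have := (abs_le.1 (pt s' h1 h2)).1
      linarith
    have hp : 0 < τ ^ (i + j) := pow_pos hτ0 _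
    rw [abs_le]
    constructor
    · rw [neg_le_sub_iff_le_add, ← sub_le_iff_le_add, le_div_iff₀ hp]
      linarith
    · rw [sub_le_iff_le_add, div_le_iff₀ hp]
      linarith
  rw [Metric.tendsto_atTop]
  intro ε hε
  set δ : ℝ := ε / (2 * (D + 1))
  have hδ : 0 < δ := by positivity
  have h3 : D * δ ≤ ε / 2 := by
    simp only [δ]
    rw [← mul_div_assoc, div_le_div_iff₀ (by positivity) (by positivity)]
    nlinarith
  have h4 : Tendsto (fun n : ℕ => D * (δ + E n / (s.1 + s.2 + k * n : ℝ) ^ 2 / δ)) atTop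
      (𝓝 (D * (δ + 0 / δ))) := ((hlim.div_const δ).const_add δ).const_mul D
  rw [zero_div, add_zero] at h4
  obtain ⟨N, hN⟩ := (h4.eventually_lt_const (show D * δ < ε by linarith)).exists_forall_of_atTop
  exact ⟨N, fun n hn => (key δ hδ n).trans_lt (hN n hn)⟩

/-! ### Negative binomial weights -/

/-- The probability that a Yule-type process, which starts from `k * r` and jumps from `k * (r + n)`
to `k * (r + n + 1)` at rate `k * (r + n)`, has made exactly `n` jumps by time `t`. It is given by
its closed form, a negative binomial weight with parameters `r` and `exp (-k t)`. -/
noncomputable def yuleProb (k r t : ℝ) (n : ℕ) : ℝ :=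
  (ascPochhammer ℝ n).eval r / n.factorial * Real.exp (-(k * r * t)) * (1 - Real.exp (-(k * t))) ^ n

section Yule

variable {k r t : ℝ}

theorem yuleProb_nonneg (hk : 0 < k) (hr : 0 < r) (ht : 0 ≤ t) (n : ℕ) : 0 ≤ yuleProb k r t n := by
  have h1 : 0 ≤ 1 - Real.exp (-(k * t)) := by
    rw [sub_nonneg, Real.exp_le_one_iff]
    have := mul_nonneg hk.le ht
    linarith
  have h2 := ascPochhammer_pos n r hr
  unfold yuleProb
  positivity

theorem yuleProb_zero : yuleProb k r t 0 = Real.exp (-(k * r * t)) := by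
  simp [yuleProb]

theorem ascPochhammer_succ_left_eval (n : ℕ) (r : ℝ) :
    (ascPochhammer ℝ (n + 1)).eval r = r * (ascPochhammer ℝ n).eval (r + 1) := by
  simp [ascPochhammer_succ_left]

theorem Gamma_add_natCast (hr : 0 < r) (n : ℕ) :
    Real.Gamma (r + n) = (ascPochhammer ℝ n).eval r * Real.Gamma r := by
  induction n with
  | zero => simp
  | succ n ih =>
    rw [Nat.cast_succ, ← add_assoc, Real.Gamma_add_one (by positivity), ih, ascPochhammer_succ_eval]
    ring

/-- Size-biasing the negative binomial weights by a rising factorial shifts the parameter `r`. -/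
theorem yuleProb_mul_ascPochhammer (p n : ℕ) :
    yuleProb k r t n * (ascPochhammer ℝ p).eval (r + n) =
      (ascPochhammer ℝ p).eval r * Real.exp (k * p * t) * yuleProb k (r + p) t n := by
  have h : ∀ a b : ℕ, (ascPochhammer ℝ (a + b)).eval r =
      (ascPochhammer ℝ a).eval r * (ascPochhammer ℝ b).eval (r + a) := by
    intro a b
    rw [← ascPochhammer_mul]
    simp
  have h1 : (ascPochhammer ℝ n).eval r * (ascPochhammer ℝ p).eval (r + n) =
      (ascPochhammer ℝ p).eval r * (ascPochhammer ℝ n).eval (r + p) := by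
    rw [← h, ← h, add_comm]
  have h2 : Real.exp (-(k * r * t)) = Real.exp (k * p * t) * Real.exp (-(k * (r + p) * t)) := by
    rw [← Real.exp_add]; congr 1; ring
  unfold yuleProb
  rw [h2]
  linear_combination (Real.exp (k * p * t) * Real.exp (-(k * (r + p) * t)) *
    (1 - Real.exp (-(k * t))) ^ n / n.factorial) * h1

/-- The negative binomial law is a mixture of Poisson laws over a gamma distributed parameter. -/
theorem integral_poisson_gammaMeasure (hk : 0 < k) (hr : 0 < r) (t : ℝ) (n : ℕ) :
    ∫ x, Real.exp (-((Real.exp (k * t) - 1) / k * x)) * ((Real.exp (k * t) - 1) / k * x) ^ n /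
      n.factorial ∂gammaMeasure r (1 / k) = yuleProb k r t n := by
  set lam := (Real.exp (k * t) - 1) / k with hlam
  have hG := Real.Gamma_pos_of_pos hr
  have h1 : ∀ x : ℝ, (gammaPDF r (1 / k) x).toReal • (Real.exp (-(lam * x)) * (lam * x) ^ n /
      n.factorial) = (Set.Ici (0 : ℝ)).indicator (fun x => (1 / k) ^ r / Real.Gamma r * lam ^ n /
        n.factorial * (x ^ (r + n - 1) * Real.exp (-((lam + 1 / k) * x)))) x := by
    intro x
    rw [gammaPDF, ENNReal.toReal_ofReal (gammaPDFReal_nonneg hr (by positivity) x), gammaPDFReal]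
    by_cases hx : 0 ≤ x
    · rw [if_pos hx, Set.indicator_of_mem (Set.mem_Ici.2 hx)]
      have e1 : Real.exp (-((lam + 1 / k) * x)) =
          Real.exp (-(lam * x)) * Real.exp (-(1 / k * x)) := by
        rw [← Real.exp_add]; congr 1; ring
      rcases hx.eq_or_lt with rfl | hx'
      · rcases Nat.eq_zero_or_pos n with rfl | hn
        · simp
        · have : (1 : ℝ) ≤ n := by exact_mod_cast hn
          rw [Real.zero_rpow (show r + n - 1 ≠ 0 by linarith)]
          simp [hn.ne']
      · have e2 : x ^ (r + n - 1) = x ^ (r - 1) * x ^ n := by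
          rw [show r + n - 1 = r - 1 + n by ring, Real.rpow_add_natCast hx'.ne']
        rw [e1, e2, smul_eq_mul, mul_pow]
        ring
    · rw [if_neg hx, Set.indicator_of_notMem (by simpa using hx)]
      simp
  have hL : lam + 1 / k = Real.exp (k * t) / k := by rw [hlam]; ring
  have hL0 : 0 < lam + 1 / k := by rw [hL]; positivity
  rw [gammaMeasure, integral_withDensity_eq_integral_toReal_smul
    (f := gammaPDF r (1 / k)) (measurable_gammaPDFReal _ _).ennreal_ofReal
    (ae_of_all _ fun x => ENNReal.ofReal_lt_top)]
  simp only [h1]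
  rw [integral_indicator measurableSet_Ici, integral_Ici_eq_integral_Ioi, integral_const_mul,
    Real.integral_rpow_mul_exp_neg_mul_Ioi (by positivity) hL0, Gamma_add_natCast hr, hL, yuleProb]
  have e3 : (1 / (Real.exp (k * t) / k)) ^ (r + n) =
      k ^ r * Real.exp (-(k * r * t)) * (k ^ n * Real.exp (-(k * t)) ^ n) := by
    rw [one_div_div, Real.rpow_add_natCast (by positivity), div_pow, Real.div_rpow hk.le
      (Real.exp_pos _).le, ← Real.exp_mul, Real.exp_neg, Real.exp_neg,
      show k * r * t = k * t * r by ring, inv_pow]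
    field_simp
  have e4 : lam ^ n * (k ^ n * Real.exp (-(k * t)) ^ n) = (1 - Real.exp (-(k * t))) ^ n := by
    rw [← mul_pow, ← mul_pow, hlam]
    congr 1
    rw [Real.exp_neg]
    field_simp
  rw [e3, ← e4, one_div, Real.inv_rpow hk.le]
  have : k ^ r ≠ 0 := (Real.rpow_pos_of_pos hk r).ne'
  field_simp

theorem ae_nonneg_gammaMeasure (a r : ℝ) : ∀ᵐ x ∂gammaMeasure a r, 0 ≤ x := by
  have h : {x : ℝ | ¬ 0 ≤ x} = Set.Iio 0 := by ext; simp
  rw [ae_iff, h, gammaMeasure, withDensity_apply _ measurableSet_Iio]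
  exact lintegral_gammaPDF_of_nonpos le_rfl

/-- The generating function of the negative binomial weights, as a mixture of Poisson ones. -/
theorem hasSum_yuleProb_mul_pow (hk : 0 < k) (hr : 0 < r) (ht : 0 ≤ t) {z : ℂ} (hz : ‖z‖ ≤ 1) :
    HasSum (fun n => (yuleProb k r t n : ℂ) * z ^ n)
      (∫ x, Complex.exp ((Real.exp (k * t) - 1) / k * x * (z - 1)) ∂gammaMeasure r (1 / k)) := by
  have := isProbabilityMeasure_gammaMeasure hr (one_div_pos.2 hk)
  set lam := (Real.exp (k * t) - 1) / k with hlam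
  have hlam0 : 0 ≤ lam := div_nonneg (sub_nonneg.2 (Real.one_le_exp (by positivity))) hk.le
  set q : ℕ → ℝ → ℝ := fun n x => Real.exp (-(lam * x)) * (lam * x) ^ n / n.factorial with hq
  have hqs : ∀ x, HasSum (fun n => q n x) 1 := by
    intro x
    have := (NormedSpace.expSeries_div_hasSum_exp (lam * x)).mul_left (Real.exp (-(lam * x)))
    rw [← Real.exp_eq_exp_ℝ, ← Real.exp_add, neg_add_cancel, Real.exp_zero] at this
    simpa only [hq, mul_div_assoc] using this
  have hint : ∀ n, (yuleProb k r t n : ℂ) * z ^ n =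
      ∫ x, (q n x : ℂ) * z ^ n ∂gammaMeasure r (1 / k) := by
    intro n
    rw [integral_mul_const, integral_complex_ofReal, integral_poisson_gammaMeasure hk hr t n]
  simp only [hint]
  refine hasSum_integral_of_dominated_convergence (fun n x => q n x)
    (fun n => by simp only [hq]; fun_prop) (fun n => ?_) (ae_of_all _ fun x => (hqs x).summable) ?_
    (ae_of_all _ fun x => ?_)
  · filter_upwards [ae_nonneg_gammaMeasure r (1 / k)] with x hx
    have : 0 ≤ q n x := by simp only [hq]; positivity
    rw [norm_mul, norm_pow, Complex.norm_real, Real.norm_of_nonneg this]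
    exact mul_le_of_le_one_right this (pow_le_one₀ (norm_nonneg _) hz)
  · simp only [(hqs _).tsum_eq]
    exact integrable_const _
  · have := (NormedSpace.expSeries_div_hasSum_exp (lam * x * z : ℂ)).mul_left
      (Complex.exp (-(lam * x)))
    rw [← Complex.exp_eq_exp_ℂ, ← Complex.exp_add] at this
    convert! this using 1
    · ext n
      simp only [hq]
      push_cast
      rw [mul_pow _ z]
      ring
    · congr 1
      simp only [hlam]
      push_cast
      ring

theorem hasSum_yuleProb (hk : 0 < k) (hr : 0 < r) (ht : 0 ≤ t) : HasSum (yuleProb k r t) 1 := by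
  have := isProbabilityMeasure_gammaMeasure hr (one_div_pos.2 hk)
  have h := hasSum_yuleProb_mul_pow hk hr ht (z := 1) (by simp)
  simp only [one_pow, mul_one, sub_self, mul_zero, Complex.exp_zero, integral_const, probReal_univ,
    one_smul] at h
  exact Complex.hasSum_ofReal.1 (by rwa [Complex.ofReal_one])

theorem tendsto_exp_neg_mul_atTop (hk : 0 < k) :
    Tendsto (fun t => Real.exp (-(k * t))) atTop (𝓝 0) :=
  Real.tendsto_exp_neg_atTop_nhds_zero.comp (tendsto_id.const_mul_atTop hk)

theorem tendsto_yuleProb_atTop (hk : 0 < k) (hr : 0 < r) (n : ℕ) :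
    Tendsto (fun t => yuleProb k r t n) atTop (𝓝 0) := by
  have h1 := tendsto_exp_neg_mul_atTop (mul_pos hk hr)
  have h2 := ((tendsto_exp_neg_mul_atTop hk).const_sub 1).pow n
  simpa [yuleProb] using (h1.const_mul ((ascPochhammer ℝ n).eval r / n.factorial)).mul h2

/-- Since each single weight vanishes as `t → ∞`, the weighted averages of a convergent sequence tend
to its limit. -/
theorem tendsto_tsum_yuleProb_mul (hk : 0 < k) (hr : 0 < r) {θ : ℕ → ℝ} {L : ℝ}
    (hθ : Tendsto θ atTop (𝓝 L)) :
    Tendsto (fun t => ∑' n, yuleProb k r t n * θ n) atTop (𝓝 L) := by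
  obtain ⟨C, hC⟩ : ∃ C, ∀ n, |θ n - L| ≤ C := by
    obtain ⟨C, hC⟩ := (hθ.sub_const L).abs.bddAbove_range
    exact ⟨C, fun n => hC ⟨n, rfl⟩⟩
  have hC0 : 0 ≤ C := (abs_nonneg _).trans (hC 0)
  rw [Metric.tendsto_atTop]
  intro ε hε
  obtain ⟨N, hN⟩ := Metric.tendsto_atTop.1 hθ (ε / 2) (by positivity)
  have hfin : Tendsto (fun t => ε / 2 + ∑ n ∈ Finset.range N, yuleProb k r t n * C) atTop
      (𝓝 (ε / 2 + ∑ n ∈ Finset.range N, 0 * C)) :=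
    (tendsto_finsetSum _ fun n _ => (tendsto_yuleProb_atTop hk hr n).mul_const C).const_add _
  simp only [zero_mul, Finset.sum_const_zero, add_zero] at hfin
  obtain ⟨T, hT⟩ := (hfin.eventually_lt_const (half_lt_self hε)).exists_forall_of_atTop
  refine ⟨max T 0, fun t ht => ?_⟩
  have ht0 : 0 ≤ t := (le_max_right _ _).trans ht
  have hp := yuleProb_nonneg hk hr ht0
  have hs := hasSum_yuleProb hk hr ht0
  refine lt_of_le_of_lt ?_ (hT t ((le_max_left _ _).trans ht))
  have hb : HasSum (fun n => yuleProb k r t n * (ε / 2) +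
      (if n ∈ Finset.range N then yuleProb k r t n * C else 0))
      (1 * (ε / 2) + ∑ n ∈ Finset.range N, yuleProb k r t n * C) := by
    refine (hs.mul_right _).add ?_
    have h := hasSum_sum_of_ne_finset_zero (L := .unconditional ℕ) (s := Finset.range N)
      (f := fun n => if n ∈ Finset.range N then yuleProb k r t n * C else 0) fun n hn => if_neg hn
    rwa [Finset.sum_congr rfl fun n hn => if_pos hn] at h
  rw [one_mul] at hb
  have hle : ∀ n, ‖yuleProb k r t n * (θ n - L)‖ ≤ yuleProb k r t n * (ε / 2) +
      (if n ∈ Finset.range N then yuleProb k r t n * C else 0) := by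
    intro n
    rw [norm_mul, Real.norm_of_nonneg (hp n)]
    split_ifs with hn
    · have := mul_le_mul_of_nonneg_left (hC n) (hp n)
      have := mul_nonneg (hp n) hε.le
      rw [Real.norm_eq_abs]
      linarith
    · rw [add_zero]
      exact mul_le_mul_of_nonneg_left (hN n (by simpa using hn)).le (hp n)
  have hsum : Summable fun n => yuleProb k r t n * (θ n - L) := .of_norm_bounded hb.summable hle
  have e : ∑' n, yuleProb k r t n * θ n = L + ∑' n, yuleProb k r t n * (θ n - L) := by
    have := (hs.mul_right L).add hsum.hasSum
    rw [one_mul] at this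
    rw [← this.tsum_eq]
    exact tsum_congr fun n => by ring
  rw [e, Real.dist_eq, add_sub_cancel_left, ← Real.norm_eq_abs]
  exact tsum_of_norm_bounded hb hle

/-- Conditioning on the first jump, which happens at rate `k * r`. -/
theorem intervalIntegral_yuleProb (n : ℕ) (k r t : ℝ) :
    ∫ u in (0 : ℝ)..t, k * r * Real.exp (-(k * r * u)) * yuleProb k (r + 1) (t - u) n =
      yuleProb k r t (n + 1) := by
  set D := (ascPochhammer ℝ n).eval (r + 1) / n.factorial with hD
  have hd : ∀ u : ℝ, HasDerivAt (fun u => -(r * D / (n + 1) * Real.exp (-(k * r * t)) *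
      (1 - Real.exp (-(k * (t - u)))) ^ (n + 1)))
      (k * r * Real.exp (-(k * r * u)) * yuleProb k (r + 1) (t - u) n) u := by
    intro u
    have h1 : HasDerivAt (fun u : ℝ => -(k * (t - u))) k u := by
      have := (((hasDerivAt_id u).const_sub t).const_mul k).fun_neg
      simpa using this
    have h2 := (((h1.exp.const_sub 1).pow (n + 1)).const_mul
      (r * D / (n + 1) * Real.exp (-(k * r * t)))).neg
    convert! h2 using 1
    have e : Real.exp (-(k * r * u)) * Real.exp (-(k * (r + 1) * (t - u))) =
        Real.exp (-(k * r * t)) * Real.exp (-(k * (t - u))) := by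
      rw [← Real.exp_add, ← Real.exp_add]; congr 1; ring
    have h3 : (n : ℝ) + 1 ≠ 0 := by positivity
    simp only [yuleProb, Nat.add_sub_cancel, ← hD]
    push_cast
    field_simp
    linear_combination (k * r * D * (1 - Real.exp (-(k * (t - u)))) ^ n) * e
  rw [intervalIntegral.integral_eq_sub_of_hasDerivAt (fun u _ => hd u)
    (Continuous.intervalIntegrable (by unfold yuleProb; fun_prop) _ _)]
  simp only [yuleProb, ascPochhammer_succ_left_eval, D, Nat.factorial_succ]
  push_cast
  have h3 : (n : ℝ) + 1 ≠ 0 := by positivity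
  simp only [sub_self, sub_zero, mul_zero, neg_zero, Real.exp_zero, zero_pow (Nat.succ_ne_zero n)]
  field_simp
  ring

theorem tendsto_mul_exp_I_sub_one (hk : 0 < k) (x : ℝ) :
    Tendsto (fun t : ℝ => ((Real.exp (k * t) - 1) / k : ℂ) *
      (Complex.exp ((Real.exp (-(k * t)) * k * x : ℝ) * Complex.I) - 1)) atTop
      (𝓝 (x * Complex.I)) := by
  have hd : HasDerivAt (fun h : ℝ => Complex.exp ((h * k * x : ℝ) * Complex.I))
      (k * x * Complex.I) 0 := by
    have h1 : HasDerivAt (fun h : ℝ => ((h * k * x : ℝ) : ℂ) * Complex.I) (k * x * Complex.I) 0 := by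
      have h2 : HasDerivAt (fun h : ℝ => h * k * x) (k * x) 0 := by
        simpa using ((hasDerivAt_id (0 : ℝ)).mul_const k).mul_const x
      simpa using h2.ofReal_comp.mul_const Complex.I
    simpa using h1.cexp
  have hs := hd.tendsto_slope_zero_right
  have hlim : Tendsto (fun t => Real.exp (-(k * t))) atTop (𝓝[>] 0) :=
    tendsto_nhdsWithin_iff.2 ⟨tendsto_exp_neg_mul_atTop hk, Eventually.of_forall fun t =>
      Real.exp_pos _⟩
  have h3 := hs.comp hlim
  have h4 : Tendsto (fun t => (((1 - Real.exp (-(k * t))) / k : ℝ) : ℂ)) atTop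
      (𝓝 (((1 - 0) / k : ℝ) : ℂ)) :=
    (Complex.continuous_ofReal.tendsto _).comp
      (((tendsto_exp_neg_mul_atTop hk).const_sub 1).div_const k)
  have h5 := h4.mul h3
  have hk' : (k : ℂ) ≠ 0 := by exact_mod_cast hk.ne'
  convert! h5 using 1
  · ext t
    have : Complex.exp (k * t) ≠ 0 := Complex.exp_ne_zero _
    simp only [Function.comp_apply, zero_add, zero_mul, Complex.ofReal_zero, Complex.exp_zero,
      Real.exp_neg, inv_inv, Complex.real_smul]
    push_cast
    field_simp
  · congr 1
    push_cast
    field_simp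
    simp

/-- The rescaled population converges to the gamma law, in terms of characteristic functions. -/
theorem tendsto_tsum_yuleProb_mul_cexp (hk : 0 < k) (hr : 0 < r) (x : ℝ) :
    Tendsto (fun t : ℝ => ∑' n : ℕ, (yuleProb k r t n : ℂ) *
      Complex.exp ((x * (Real.exp (-(k * t)) * (k * (r + n))) : ℝ) * Complex.I)) atTop
      (𝓝 (charFun (gammaMeasure r (1 / k)) x)) := by
  have := isProbabilityMeasure_gammaMeasure hr (one_div_pos.2 hk)
  set z : ℝ → ℂ := fun t => Complex.exp ((Real.exp (-(k * t)) * k * x : ℝ) * Complex.I) with hz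
  have hz1 : ∀ t, ‖z t‖ = 1 := fun t => Complex.norm_exp_ofReal_mul_I _
  set a : ℝ → ℂ := fun t => ((Real.exp (k * t) - 1) / k : ℂ) * (z t - 1) with ha
  have h1 : ∀ t, 0 ≤ t → ∑' n : ℕ, (yuleProb k r t n : ℂ) *
      Complex.exp ((x * (Real.exp (-(k * t)) * (k * (r + n))) : ℝ) * Complex.I) =
        Complex.exp ((x * (Real.exp (-(k * t)) * (k * r)) : ℝ) * Complex.I) *
          ∫ y : ℝ, Complex.exp (y * a t) ∂gammaMeasure r (1 / k) := by
    intro t ht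
    have h2 := (hasSum_yuleProb_mul_pow hk hr ht (hz1 t).le).mul_left
      (Complex.exp ((x * (Real.exp (-(k * t)) * (k * r)) : ℝ) * Complex.I))
    have h3 : ∀ y : ℝ, Complex.exp (y * a t) =
        Complex.exp ((Real.exp (k * t) - 1) / k * y * (z t - 1)) := by
      intro y; simp only [ha]; congr 1; ring
    simp only [h3]
    rw [← h2.tsum_eq]
    refine tsum_congr fun n => ?_
    simp only [hz]
    rw [← Complex.exp_nat_mul, mul_left_comm (Complex.exp _), ← Complex.exp_add]
    congr 2
    push_cast
    ring
  have h4 : Tendsto (fun t => Complex.exp ((x * (Real.exp (-(k * t)) * (k * r)) : ℝ) * Complex.I) *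
      ∫ y : ℝ, Complex.exp (y * a t) ∂gammaMeasure r (1 / k)) atTop
      (𝓝 (Complex.exp ((x * (0 * (k * r)) : ℝ) * Complex.I) *
        ∫ y : ℝ, Complex.exp (y * (x * Complex.I)) ∂gammaMeasure r (1 / k))) := by
    refine Tendsto.mul ?_ ?_
    · have hc : Continuous fun h : ℝ => Complex.exp ((x * (h * (k * r)) : ℝ) * Complex.I) := by
        fun_prop
      exact (hc.tendsto 0).comp (tendsto_exp_neg_mul_atTop hk)
    · refine tendsto_integral_filter_of_dominated_convergence (fun _ => 1)
        (Eventually.of_forall fun t => by fun_prop) ?_ (integrable_const _)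
        (ae_of_all _ fun y => ?_)
      · filter_upwards [eventually_ge_atTop 0] with t ht
        filter_upwards [ae_nonneg_gammaMeasure r (1 / k)] with y hy
        rw [Complex.norm_exp, Real.exp_le_one_iff]
        have e : (y * a t).re = -(y * ((Real.exp (k * t) - 1) / k) * (1 - (z t).re)) := by
          have : y * a t = (y * ((Real.exp (k * t) - 1) / k) : ℝ) * (z t - 1) := by
            simp only [ha]; push_cast; ring
          rw [this, Complex.re_ofReal_mul, Complex.sub_re, Complex.one_re]
          ring
        rw [e, neg_nonpos]
        have e2 : 0 ≤ Real.exp (k * t) - 1 := sub_nonneg.2 (Real.one_le_exp (by positivity))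
        have e3 : 0 ≤ 1 - (z t).re :=
          sub_nonneg.2 ((Complex.re_le_norm _).trans (hz1 t).le)
        positivity
      · have hc : Continuous fun w : ℂ => Complex.exp (y * w) := by fun_prop
        exact (hc.tendsto _).comp (tendsto_mul_exp_I_sub_one hk x)
  have h5 : charFun (gammaMeasure r (1 / k)) x =
      Complex.exp ((x * (0 * (k * r)) : ℝ) * Complex.I) *
        ∫ y : ℝ, Complex.exp (y * (x * Complex.I)) ∂gammaMeasure r (1 / k) := by
    rw [charFun_apply_real]
    simp only [zero_mul, mul_zero, Complex.ofReal_zero, Complex.exp_zero, one_mul]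
    congr 1 with y
    congr 1
    ring
  rw [h5]
  refine h4.congr' ?_
  filter_upwards [eventually_ge_atTop 0] with t ht
  exact (h1 t ht).symm

/-- If `e n / (k * (r + n)) ^ p` tends to `L`, then the `yuleProb`-average of `e`, divided by
`exp (k p t)`, tends to `L` times the `p`-th moment of the gamma law of shape `r` and scale `k`.
Powers of `r + n` may be replaced by rising factorials, which only shift the parameter `r`. -/
theorem tendsto_tsum_yuleProb_mul_div_exp (hk : 0 < k) (hr : 0 < r) {e : ℕ → ℝ} {L : ℝ} (p : ℕ)
    (he : Tendsto (fun n : ℕ => e n / (k * (r + n)) ^ p) atTop (𝓝 L)) :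
    (∀ t, 0 ≤ t → Summable fun n => yuleProb k r t n * e n) ∧
    Tendsto (fun t => (∑' n, yuleProb k r t n * e n) / Real.exp (k * p * t)) atTop
      (𝓝 (L * k ^ p * (ascPochhammer ℝ p).eval r)) := by
  have hrn : Tendsto (fun n : ℕ => r + n) atTop atTop :=
    tendsto_atTop_add_const_left _ _ tendsto_natCast_atTop_atTop
  set θ : ℕ → ℝ := fun n => e n / (ascPochhammer ℝ p).eval (r + n) with hθ
  have hpos : ∀ n : ℕ, 0 < (ascPochhammer ℝ p).eval (r + n) := fun n =>
    ascPochhammer_pos p _ (by positivity)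
  have hθL : Tendsto θ atTop (𝓝 (L * k ^ p)) := by
    have h1 : Tendsto (fun n : ℕ => (r + n) ^ p / (ascPochhammer ℝ p).eval (r + n)) atTop (𝓝 1) := by
      have := Polynomial.isEquivalent_atTop_lead (ascPochhammer ℝ p)
      rw [(monic_ascPochhammer ℝ p).leadingCoeff, ascPochhammer_natDegree] at this
      simp only [one_mul] at this
      have h2 := (Asymptotics.isEquivalent_iff_tendsto_one ?_).1 this.symm
      · exact h2.comp hrn
      · filter_upwards [eventually_gt_atTop 0] with x hx
        exact (ascPochhammer_pos p x hx).ne'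
    have h2 := (he.mul_const (k ^ p)).mul h1
    rw [mul_one] at h2
    refine h2.congr fun n => ?_
    have := hpos n
    simp only [hθ, mul_pow]
    field_simp
  have hterm : ∀ t n, yuleProb k r t n * e n = (ascPochhammer ℝ p).eval r * Real.exp (k * p * t) *
      (yuleProb k (r + p) t n * θ n) := by
    intro t n
    have := yuleProb_mul_ascPochhammer (k := k) (r := r) (t := t) p n
    have h3 := hpos n
    rw [← mul_assoc, ← this]
    simp only [hθ]
    field_simp
  have hrp : 0 < r + p := by positivity
  constructor
  · intro t ht
    simp only [hterm]
    refine Summable.mul_left _ ?_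
    obtain ⟨C, hC⟩ := hθL.abs.bddAbove_range
    refine .of_norm_bounded ((hasSum_yuleProb hk hrp ht).summable.mul_right C) fun n => ?_
    rw [norm_mul, Real.norm_of_nonneg (yuleProb_nonneg hk hrp ht n)]
    exact mul_le_mul_of_nonneg_left (hC ⟨n, rfl⟩) (yuleProb_nonneg hk hrp ht n)
  · have h4 := (tendsto_tsum_yuleProb_mul hk hrp hθL).mul_const ((ascPochhammer ℝ p).eval r)
    refine h4.congr fun t => ?_
    simp only [hterm, tsum_mul_left]
    field_simp

end Yule

/-! ### Independent exponential clocks -/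

instance isProbabilityMeasure_expMeasure_one : IsProbabilityMeasure (expMeasure 1) :=
  isProbabilityMeasure_expMeasure one_pos

theorem expMeasure_one_Ioi {u : ℝ} (hu : 0 ≤ u) :
    expMeasure 1 (Set.Ioi u) = ENNReal.ofReal (Real.exp (-u)) := by
  have h := cdf_expMeasure_eq one_pos u
  rw [if_pos hu, one_mul] at h
  rw [← Set.compl_Iic, prob_compl_eq_one_sub measurableSet_Iic, ← ofReal_cdf, h,
    ← ENNReal.ofReal_one, ← ENNReal.ofReal_sub _ (by simpa using hu)]
  simp

theorem lintegral_expMeasure_one {f : ℝ → ENNReal} (hf : Measurable f) :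
    ∫⁻ u, f u ∂expMeasure 1 = ∫⁻ u in Set.Ioi 0, ENNReal.ofReal (Real.exp (-u)) * f u := by
  have hm : Measurable (gammaPDF 1 1) := (measurable_gammaPDFReal 1 1).ennreal_ofReal
  rw [expMeasure, gammaMeasure, lintegral_withDensity_eq_lintegral_mul _ hm hf,
    ← setLIntegral_congr (Ioi_ae_eq_Ici (μ := volume) (a := (0 : ℝ))).symm,
    ← lintegral_indicator measurableSet_Ici]
  refine lintegral_congr fun u => ?_
  by_cases hu : 0 ≤ u
  · rw [Set.indicator_of_mem (Set.mem_Ici.2 hu), Pi.mul_apply, gammaPDF_of_nonneg hu]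
    simp
  · rw [Set.indicator_of_notMem (by simpa using hu), Pi.mul_apply,
      gammaPDF_of_neg (not_le.1 hu), zero_mul]

/-- Ball number `m` of `N + 1` rings strictly before all others, at a time with density
`exp (-(N + 1) u)`. -/
theorem lintegral_pi_expMeasure_indicator (N : ℕ) (m : Fin (N + 1)) {f : ℝ → ENNReal}
    (hf : Measurable f) :
    ∫⁻ y, {y : Fin (N + 1) → ℝ | ∀ j, j ≠ m → y m < y j}.indicator (fun y => f (y m)) y
      ∂Measure.pi (fun _ => expMeasure 1) =
    ∫⁻ u in Set.Ioi 0, ENNReal.ofReal (Real.exp (-((N + 1 : ℕ) * u))) * f u := by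
  have hS : MeasurableSet {p : ℝ × (Fin N → ℝ) | ∀ j, p.1 < p.2 j} := by
    rw [Set.ofPred_forall]
    exact MeasurableSet.iInter fun j => measurableSet_lt (by fun_prop) (by fun_prop)
  have hg : Measurable ({p : ℝ × (Fin N → ℝ) | ∀ j, p.1 < p.2 j}.indicator fun p => f p.1) :=
    (hf.comp measurable_fst).indicator hS
  have h1 := (measurePreserving_piFinSuccAbove (fun _ : Fin (N + 1) => expMeasure 1)
    m).lintegral_comp hg
  have h2 : ∀ y : Fin (N + 1) → ℝ, {p : ℝ × (Fin N → ℝ) | ∀ j, p.1 < p.2 j}.indicator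
      (fun p => f p.1) (MeasurableEquiv.piFinSuccAbove (fun _ => ℝ) m y) =
      {y : Fin (N + 1) → ℝ | ∀ j, j ≠ m → y m < y j}.indicator (fun y => f (y m)) y := by
    intro y
    have h3 : (MeasurableEquiv.piFinSuccAbove (fun _ => ℝ) m y) ∈
        {p : ℝ × (Fin N → ℝ) | ∀ j, p.1 < p.2 j} ↔
        y ∈ {y : Fin (N + 1) → ℝ | ∀ j, j ≠ m → y m < y j} := by
      simp only [Set.mem_ofPred_eq]
      rw [Fin.forall_iff_succAbove m]
      simp [MeasurableEquiv.piFinSuccAbove_apply, Fin.insertNthEquiv, Fin.removeNth]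
    by_cases h4 : y ∈ {y : Fin (N + 1) → ℝ | ∀ j, j ≠ m → y m < y j}
    · rw [Set.indicator_of_mem h4, Set.indicator_of_mem (h3.2 h4)]
      simp [MeasurableEquiv.piFinSuccAbove_apply, Fin.insertNthEquiv]
    · rw [Set.indicator_of_notMem h4, Set.indicator_of_notMem (mt h3.1 h4)]
  simp only [h2] at h1
  rw [h1, lintegral_prod _ hg.aemeasurable]
  have h5 : ∀ u : ℝ, ∫⁻ z, {p : ℝ × (Fin N → ℝ) | ∀ j, p.1 < p.2 j}.indicator
      (fun p => f p.1) (u, z) ∂Measure.pi (fun _ : Fin N => expMeasure 1) =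
      f u * expMeasure 1 (Set.Ioi u) ^ N := by
    intro u
    have h6 : ∀ z : Fin N → ℝ, {p : ℝ × (Fin N → ℝ) | ∀ j, p.1 < p.2 j}.indicator
        (fun p => f p.1) (u, z) = (Set.univ.pi fun _ : Fin N => Set.Ioi u).indicator
          (fun _ => f u) z := by
      intro z
      by_cases hz : ∀ j, u < z j
      · have hz' : z ∈ Set.univ.pi fun _ : Fin N => Set.Ioi u := fun j _ => hz j
        rw [Set.indicator_of_mem hz']
        have hz2 : (u, z) ∈ {p : ℝ × (Fin N → ℝ) | ∀ j, p.1 < p.2 j} := hz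
        rw [Set.indicator_of_mem hz2]
      · have hz' : z ∉ Set.univ.pi fun _ : Fin N => Set.Ioi u := fun h => hz fun j => h j trivial
        rw [Set.indicator_of_notMem hz']
        have hz2 : (u, z) ∉ {p : ℝ × (Fin N → ℝ) | ∀ j, p.1 < p.2 j} := hz
        rw [Set.indicator_of_notMem hz2]
    simp only [h6]
    rw [lintegral_indicator_const (MeasurableSet.univ_pi fun _ => measurableSet_Ioi), Measure.pi_pi]
    simp
  simp only [h5]
  rw [lintegral_expMeasure_one]
  · refine setLIntegral_congr_fun measurableSet_Ioi fun u hu => ?_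
    have hu' : 0 < u := hu
    rw [expMeasure_one_Ioi hu'.le, mul_comm (f u), ← mul_assoc, ← ENNReal.ofReal_pow
      (Real.exp_pos _).le, ← ENNReal.ofReal_mul (Real.exp_pos _).le, ← Real.exp_nat_mul,
      ← Real.exp_add]
    congr 3
    push_cast
    ring
  · have h7 : Measurable fun u : ℝ => expMeasure 1 (Set.Ioi u) :=
      Antitone.measurable fun u v huv => measure_mono (Set.Ioi_subset_Ioi huv)
    exact hf.mul (h7.pow_const N)

/-! ### The first ring -/

/-- If ball `m` rings strictly before the other balls, it determines the first step. -/
theorem step_waitingTime_of_lt {R : Matrix (Fin 2) (Fin 2) ℤ} {w β m : ℕ} {x : ℕ → ℝ}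
    (hm : m < w + β) (h : ∀ j < w + β, j ≠ m → x m < x j) :
    waitingTime (w, β) x = x m ∧
      step R (w, β) x = if m < w then pickWhite R (w, β) else pickBlue R (w, β) := by
  have hN : ((w : ℤ) + β).toNat = w + β := by omega
  have h1 : waitingTime (w, β) x = x m := by
    unfold waitingTime
    have : Nonempty (Fin ((w : ℤ) + β).toNat) := ⟨⟨m, by omega⟩⟩
    refine le_antisymm (ciInf_le (Set.finite_range _).bddBelow
      (⟨m, by omega⟩ : Fin ((w : ℤ) + β).toNat)) (le_ciInf fun j => ?_)
    rcases eq_or_ne (j : ℕ) m with h2 | h2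
    · rw [h2]
    · exact (h j (by have := j.2; simp only at this; omega) h2).le
  refine ⟨h1, ?_⟩
  unfold step
  rw [h1]
  refine if_congr ⟨?_, fun h2 => ⟨m, by simpa using h2, rfl⟩⟩ rfl rfl
  rintro ⟨j, hj, hj'⟩
  have hj2 : j < w := by simpa using hj
  by_contra h3
  have := h j (by omega) (by omega)
  linarith

section Measurability

variable (R : Matrix (Fin 2) (Fin 2) ℤ)

theorem measurable_waitingTime (s : ℤ × ℤ) : Measurable (waitingTime s) :=
  Measurable.iInf fun _ => measurable_pi_apply _

theorem measurable_step (s : ℤ × ℤ) : Measurable (step R s) := by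
  classical
  unfold step
  refine Measurable.ite ?_ measurable_const measurable_const
  have : {x : ℕ → ℝ | ∃ m < s.1.toNat, x m = waitingTime s x} =
      ⋃ m, ⋃ (_ : m < s.1.toNat), {x : ℕ → ℝ | x m = waitingTime s x} := by
    ext x; simp
  rw [this]
  exact MeasurableSet.iUnion fun m => MeasurableSet.iUnion fun _ =>
    measurableSet_eq_fun (measurable_pi_apply m) (measurable_waitingTime s)

theorem measurable_urn (s : ℤ × ℤ) (n : ℕ) : Measurable fun x => urn R s x n := by
  induction n with
  | zero => exact measurable_const
  | succ n ih =>
    have h : Measurable fun p : (ℤ × ℤ) × (ℕ → ℝ) => step R p.1 p.2 :=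
      measurable_from_prod_countable_right fun s' => measurable_step R s'
    exact h.comp (ih.prodMk (measurable_pi_apply n))

theorem measurable_ringTime (s : ℤ × ℤ) (n : ℕ) : Measurable fun x => ringTime R s x n := by
  have h : Measurable fun p : (ℤ × ℤ) × (ℕ → ℝ) => waitingTime p.1 p.2 :=
    measurable_from_prod_countable_right fun s' => measurable_waitingTime s'
  have h' : ∀ l, Measurable fun x : ℕ → ℕ → ℝ => waitingTime (urn R s x l) (x l) := fun l =>
    h.comp (f := fun x : ℕ → ℕ → ℝ => (urn R s x l, x l))
      ((measurable_urn R s l).prodMk (measurable_pi_apply l))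
  exact Finset.measurable_fun_sum _ fun l _ => h' l

end Measurability

section FirstStep

variable {Ω : Type*} [MeasurableSpace Ω] {P : Measure Ω}

theorem lintegral_Ioi_exp_neg_mul {c : ℝ} (hc : 0 < c) :
    ∫⁻ u in Set.Ioi 0, ENNReal.ofReal (Real.exp (-(c * u))) = ENNReal.ofReal (1 / c) := by
  have h := integral_exp_mul_Ioi (neg_lt_zero.2 hc) 0
  have hi : IntegrableOn (fun u => Real.exp (-(c * u))) (Set.Ioi 0) := by
    simpa [neg_mul] using exp_neg_integrableOn_Ioi 0 hc
  rw [← ofReal_integral_eq_lintegral_ofReal hi (ae_of_all _ fun u => (Real.exp_pos _).le)]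
  simp only [neg_mul] at h
  rw [h]
  simp

/-- The law of the first step: in the state `(w, β)` a white ball rings first at time `u` with
density `w * exp (-(w + β) u)`, a blue one with density `β * exp (-(w + β) u)`. -/
theorem lintegral_step_waitingTime [IsProbabilityMeasure P] {X : ℕ → Ω → ℝ}
    (hXm : ∀ m, Measurable (X m)) (hXl : ∀ m, HasLaw (X m) (expMeasure 1) P) (hXi : iIndepFun X P)
    (R : Matrix (Fin 2) (Fin 2) ℤ) {w β : ℕ} (hN : 0 < w + β) {F : ℤ × ℤ → ℝ → ENNReal}
    (hF : ∀ s, Measurable (F s)) :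
    ∫⁻ ω, F (step R (w, β) fun m => X m ω) (waitingTime (w, β) fun m => X m ω) ∂P =
      ∫⁻ u in Set.Ioi 0, ENNReal.ofReal (Real.exp (-((w + β : ℝ) * u))) *
        (w * F (pickWhite R (w, β)) u + β * F (pickBlue R (w, β)) u) := by
  obtain ⟨N, hN⟩ := Nat.exists_eq_succ_of_ne_zero hN.ne'
  set A : Fin (N + 1) → Set Ω := fun m => {ω | ∀ j : Fin (N + 1), j ≠ m → X m ω < X j ω} with hA
  have hAm : ∀ m, MeasurableSet (A m) := fun m => by
    simp only [hA, Set.ofPred_forall]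
    exact MeasurableSet.iInter fun j => MeasurableSet.iInter fun _ => measurableSet_lt (hXm _) (hXm _)
  have hAd : Pairwise (Function.onFun Disjoint A) := by
    intro i j hij
    refine Set.disjoint_left.2 fun ω h1 h2 => ?_
    exact lt_asymm (h1 j hij.symm) (h2 i hij)
  have hY : Measurable fun ω (j : Fin (N + 1)) => X j ω := measurable_pi_lambda _ fun j => hXm _
  have hmap : P.map (fun ω (j : Fin (N + 1)) => X j ω) = Measure.pi fun _ => expMeasure 1 := by
    rw [(hXi.precomp (g := fun j : Fin (N + 1) => (j : ℕ)) Fin.val_injective).map_fun_eq_pi_map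
      fun j => (hXm _).aemeasurable]
    congr 1
    ext1 j
    exact (hXl j).map_eq
  have hone : ∀ (m : Fin (N + 1)) (f : ℝ → ENNReal), Measurable f →
      ∫⁻ ω, (A m).indicator (fun ω => f (X m ω)) ω ∂P =
        ∫⁻ u in Set.Ioi 0, ENNReal.ofReal (Real.exp (-((N + 1 : ℕ) * u))) * f u := by
    intro m f hf
    rw [← lintegral_pi_expMeasure_indicator N m hf, ← hmap, lintegral_map _ hY]
    · rfl
    · refine (hf.comp (measurable_pi_apply m)).indicator ?_
      simp only [Set.ofPred_forall]
      exact MeasurableSet.iInter fun j => MeasurableSet.iInter fun _ =>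
        measurableSet_lt (by fun_prop) (by fun_prop)
  -- the `N + 1` events have probability `1 / (N + 1)` each, so one of them occurs almost surely
  have hPA : ∀ m, P (A m) = ENNReal.ofReal (1 / (N + 1 : ℕ)) := by
    intro m
    have := hone m (fun _ => 1) measurable_const
    simp only [mul_one] at this
    rw [lintegral_Ioi_exp_neg_mul (by positivity), lintegral_indicator_const (hAm m), one_mul] at this
    exact this
  have hae : ∀ᵐ ω ∂P, ω ∈ ⋃ m, A m := by
    rw [ae_iff]
    change P (⋃ m, A m)ᶜ = 0
    rw [prob_compl_eq_zero_iff (MeasurableSet.iUnion hAm), measure_iUnion hAd hAm]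
    simp only [hPA]
    rw [tsum_fintype, Finset.sum_const, Finset.card_univ, Fintype.card_fin, nsmul_eq_mul,
      ← ENNReal.ofReal_natCast, ← ENNReal.ofReal_mul (by positivity),
      mul_one_div_cancel (by positivity), ENNReal.ofReal_one]
  have hpt : ∀ᵐ ω ∂P, F (step R (w, β) fun m => X m ω) (waitingTime (w, β) fun m => X m ω) =
      ∑ m : Fin (N + 1), (A m).indicator (fun ω => F (if (m : ℕ) < w then pickWhite R (w, β)
        else pickBlue R (w, β)) (X m ω)) ω := by
    filter_upwards [hae] with ω hω
    obtain ⟨m, hm⟩ := Set.mem_iUnion.1 hω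
    obtain ⟨h1, h2⟩ := step_waitingTime_of_lt (R := R) (w := w) (β := β) (m := (m : ℕ))
      (x := fun m => X m ω) (by omega) (fun j hj hjm => hm ⟨j, by omega⟩ (by
        intro h; exact hjm (congrArg Fin.val h)))
    rw [h1, h2, Finset.sum_eq_single m]
    · rw [Set.indicator_of_mem hm]
    · intro j _ hj
      exact Set.indicator_of_notMem (fun h => Set.disjoint_left.1 (hAd hj) h hm) _
    · simp
  rw [lintegral_congr_ae hpt, lintegral_finsetSum]
  · set D : ℕ → ENNReal := fun m => ∫⁻ u in Set.Ioi 0,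
      ENNReal.ofReal (Real.exp (-((N + 1 : ℕ) * u))) *
        F (if m < w then pickWhite R (w, β) else pickBlue R (w, β)) u with hD
    have : ∀ m : Fin (N + 1), ∫⁻ ω, (A m).indicator (fun ω => F (if (m : ℕ) < w then
        pickWhite R (w, β) else pickBlue R (w, β)) (X m ω)) ω ∂P =
        D m :=
      fun m => hone m _ (hF _)
    have hN' : ((N + 1 : ℕ) : ℝ) = w + β := by exact_mod_cast hN.symm
    have hme : ∀ (c : ℝ) s, Measurable fun u => ENNReal.ofReal (Real.exp (-(c * u))) * F s u :=
      fun c s => (by fun_prop : Measurable fun u : ℝ =>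
        ENNReal.ofReal (Real.exp (-(c * u)))).mul (hF s)
    rw [Finset.sum_congr rfl fun m _ => this m, Fin.sum_univ_eq_sum_range D (N + 1), ← Nat.succ_eq_add_one,
      ← hN, Finset.sum_range_add]
    simp only [hD]
    rw [Finset.sum_congr rfl fun m hm => by rw [if_pos (Finset.mem_range.1 hm)],
      Finset.sum_congr (s₁ := Finset.range β) rfl fun m hm => by rw [if_neg (by omega)]]
    simp only [Finset.sum_const, Finset.card_range, nsmul_eq_mul, hN']
    rw [← lintegral_const_mul _ (hme _ _), ← lintegral_const_mul _ (hme _ _), ← lintegral_add_left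
      ((hme _ _).const_mul _)]
    refine lintegral_congr fun u => ?_
    ring
  · exact fun m _ => ((hF _).comp (hXm _)).indicator (hAm m)

/-- Freezing an independent variable. -/
theorem lintegral_indepFun_prod [IsProbabilityMeasure P] {α β : Type*} [MeasurableSpace α]
    [MeasurableSpace β] {X : Ω → α} {Y : Ω → β} (hX : Measurable X) (hY : Measurable Y)
    (h : IndepFun X Y P) {f : α × β → ENNReal} (hf : Measurable f) :
    ∫⁻ ω, f (X ω, Y ω) ∂P = ∫⁻ ω, ∫⁻ ω', f (X ω, Y ω') ∂P ∂P := by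
  have := Measure.isProbabilityMeasure_map (μ := P) hX.aemeasurable
  have := Measure.isProbabilityMeasure_map (μ := P) hY.aemeasurable
  rw [← lintegral_map hf (hX.prodMk hY), (indepFun_iff_map_prod_eq_prod_map_map hX.aemeasurable
    hY.aemeasurable).1 h, lintegral_prod _ hf.aemeasurable, lintegral_map hf.lintegral_prod_right' hX]
  refine lintegral_congr fun ω => ?_
  exact lintegral_map (f := fun y => f (X ω, y)) (hf.comp measurable_prodMk_left) hY

/-! ### Factorization of colours and ring times -/

/-- A family of independent `Exp(1)` clocks. -/
structure IsClocks (ξ : ℕ → ℕ → Ω → ℝ) (P : Measure Ω) : Prop where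
  meas : ∀ n m, Measurable (ξ n m)
  law : ∀ n m, HasLaw (ξ n m) (expMeasure 1) P
  indep : iIndepFun (fun p : ℕ × ℕ => ξ p.1 p.2) P

variable {ξ : ℕ → ℕ → Ω → ℝ}

theorem IsClocks.shift (h : IsClocks ξ P) : IsClocks (fun n => ξ (n + 1)) P where
  meas n := h.meas _
  law n := h.law _
  indep := h.indep.precomp (g := fun p : ℕ × ℕ => (p.1 + 1, p.2)) fun p q hpq => by
    simp only [Prod.mk.injEq, Nat.add_right_cancel_iff] at hpq
    exact Prod.ext hpq.1 hpq.2

theorem IsClocks.measurable (h : IsClocks ξ P) : Measurable fun ω n m => ξ n m ω :=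
  measurable_pi_lambda _ fun n => measurable_pi_lambda _ fun m => h.meas n m

theorem IsClocks.indepFun_shift (h : IsClocks ξ P) :
    IndepFun (fun ω m => ξ 0 m ω) (fun ω n m => ξ (n + 1) m ω) P := by
  set M : ℕ × ℕ → MeasurableSpace Ω := fun p => MeasurableSpace.comap (ξ p.1 p.2) inferInstance
  have h1 := indep_iSup_of_disjoint (m := M) (fun p => (h.meas _ _).comap_le) h.indep.iIndep
    (S := {p | p.1 = 0}) (T := {p | p.1 ≠ 0})
    (Set.disjoint_left.2 fun p hp hp' => hp' hp)
  have key : ∀ (S : Set (ℕ × ℕ)) (p : ℕ × ℕ), p ∈ S → Measurable[⨆ q ∈ S, M q] (ξ p.1 p.2) :=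
    fun S p hp => measurable_iff_comap_le.2 (le_iSup₂ (f := fun q (_ : q ∈ S) => M q) p hp)
  have h2 : MeasurableSpace.comap (fun ω m => ξ 0 m ω) inferInstance ≤
      ⨆ q ∈ {p : ℕ × ℕ | p.1 = 0}, M q :=
    measurable_iff_comap_le.1 (@measurable_pi_lambda _ _ _ (_) _ _ fun m => key _ (0, m) rfl)
  have h3 : MeasurableSpace.comap (fun ω n m => ξ (n + 1) m ω) inferInstance ≤
      ⨆ q ∈ {p : ℕ × ℕ | p.1 ≠ 0}, M q :=
    measurable_iff_comap_le.1 (@measurable_pi_lambda _ _ _ (_) _ _ fun n =>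
      @measurable_pi_lambda _ _ _ (_) _ _ fun m => key _ (n + 1, m) (Nat.succ_ne_zero n))
  exact (indep_of_indep_of_le_left (indep_of_indep_of_le_right h1 h3) h2)

theorem IsClocks.ae_nonneg (h : IsClocks ξ P) : ∀ᵐ ω ∂P, ∀ n m, 0 ≤ ξ n m ω := by
  refine ae_all_iff.2 fun n => ae_all_iff.2 fun m => ?_
  have h1 : ∀ᵐ x ∂expMeasure 1, 0 ≤ x := ae_nonneg_gammaMeasure 1 1
  rw [← (h.law n m).map_eq] at h1
  exact ae_of_ae_map (h.meas n m).aemeasurable h1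

variable {R : Matrix (Fin 2) (Fin 2) ℤ}

theorem urn_succ_eq (s : ℤ × ℤ) (x : ℕ → ℕ → ℝ) (n : ℕ) :
    urn R s x (n + 1) = urn R (step R s (x 0)) (fun l => x (l + 1)) n := by
  induction n with
  | zero => rfl
  | succ n ih => rw [urn, ih, urn]

theorem ringTime_succ_eq (s : ℤ × ℤ) (x : ℕ → ℕ → ℝ) (n : ℕ) :
    ringTime R s x (n + 1) =
      waitingTime s (x 0) + ringTime R (step R s (x 0)) (fun l => x (l + 1)) n := by
  rw [ringTime, Finset.sum_range_succ', add_comm]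
  simp only [urn_succ_eq]
  rfl

theorem monotone_ringTime {x : ℕ → ℕ → ℝ} (hx : ∀ n m, 0 ≤ x n m) (s : ℤ × ℤ) :
    Monotone (ringTime R s x) :=
  monotone_nat_of_le_succ fun n => by
    rw [ringTime, ringTime, Finset.sum_range_succ]
    exact le_add_of_nonneg_right (Real.iInf_nonneg fun m => hx _ _)

theorem ringTime_nonneg {x : ℕ → ℕ → ℝ} (hx : ∀ n m, 0 ≤ x n m) (s : ℤ × ℤ) (n : ℕ) :
    0 ≤ ringTime R s x n := by
  simpa [ringTime] using monotone_ringTime (R := R) hx s (Nat.zero_le n)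

/-- The clock readings for which exactly `n` rings have occurred up to time `t`. -/
def ringEvent (R : Matrix (Fin 2) (Fin 2) ℤ) (s : ℤ × ℤ) (n : ℕ) (t : ℝ) : Set (ℕ → ℕ → ℝ) :=
  {x | ringTime R s x n ≤ t ∧ t < ringTime R s x (n + 1)}

theorem measurableSet_ringEvent_prod (s : ℤ × ℤ) (n : ℕ) :
    MeasurableSet {p : ℝ × (ℕ → ℕ → ℝ) | p.2 ∈ ringEvent R s n p.1} :=
  (measurableSet_le ((measurable_ringTime R s n).comp measurable_snd) measurable_fst).inter
    (measurableSet_lt measurable_fst ((measurable_ringTime R s (n + 1)).comp measurable_snd))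

theorem measurableSet_ringEvent (s : ℤ × ℤ) (n : ℕ) (t : ℝ) :
    MeasurableSet (ringEvent R s n t) :=
  measurable_prodMk_left (x := t) (measurableSet_ringEvent_prod (R := R) s n)

theorem mem_ringEvent_succ (s : ℤ × ℤ) (n : ℕ) (t : ℝ) (x : ℕ → ℕ → ℝ) :
    x ∈ ringEvent R s (n + 1) t ↔
      (fun l => x (l + 1)) ∈ ringEvent R (step R s (x 0)) n (t - waitingTime s (x 0)) := by
  simp only [ringEvent, Set.mem_ofPred_eq, ringTime_succ_eq s x, le_sub_iff_add_le',
    sub_lt_iff_lt_add']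

/-- Decomposition at the first ring, after which the process starts afresh with the clocks of the
later rings. -/
theorem lintegral_first_step [IsProbabilityMeasure P] (hξ : IsClocks ξ P) {w β : ℕ}
    (hN : 0 < w + β) {G : ℤ × ℤ → ℝ → (ℕ → ℕ → ℝ) → ENNReal}
    (hG : ∀ s, Measurable fun p : ℝ × (ℕ → ℕ → ℝ) => G s p.1 p.2) (t : ℝ) :
    ∫⁻ ω, G (step R (w, β) fun m => ξ 0 m ω) (t - waitingTime (w, β) fun m => ξ 0 m ω)
        (fun n m => ξ (n + 1) m ω) ∂P =
      ∫⁻ u in Set.Ioi 0, ENNReal.ofReal (Real.exp (-((w + β : ℝ) * u))) *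
        (w * ∫⁻ ω, G (pickWhite R (w, β)) (t - u) (fun n m => ξ (n + 1) m ω) ∂P +
          β * ∫⁻ ω, G (pickBlue R (w, β)) (t - u) (fun n m => ξ (n + 1) m ω) ∂P) := by
  have hG' : Measurable fun p : (ℤ × ℤ) × (ℝ × (ℕ → ℕ → ℝ)) => G p.1 p.2.1 p.2.2 :=
    measurable_from_prod_countable_right hG
  have hf : Measurable fun p : (ℕ → ℝ) × (ℕ → ℕ → ℝ) =>
      G (step R (w, β) p.1) (t - waitingTime (w, β) p.1) p.2 :=
    hG'.comp (f := fun p : (ℕ → ℝ) × (ℕ → ℕ → ℝ) =>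
      (step R (w, β) p.1, (t - waitingTime (w, β) p.1, p.2)))
      (((measurable_step R _).comp measurable_fst).prodMk
        ((measurable_const.sub ((measurable_waitingTime _).comp measurable_fst)).prodMk
          measurable_snd))
  have hQ : ∀ s, Measurable fun v => ∫⁻ ω, G s v (fun n m => ξ (n + 1) m ω) ∂P := by
    intro s
    have h : Measurable fun p : ℝ × Ω => G s p.1 (fun n m => ξ (n + 1) m p.2) :=
      (hG s).comp (f := fun p : ℝ × Ω => (p.1, fun n m => ξ (n + 1) m p.2))
        (measurable_fst.prodMk (hξ.shift.measurable.comp measurable_snd))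
    exact h.lintegral_prod_right'
  have hrow : iIndepFun (fun m => ξ 0 m) P :=
    hξ.indep.precomp (g := fun m : ℕ => (0, m)) fun p q hpq => by simpa using hpq
  have h1 := lintegral_indepFun_prod
    (measurable_pi_lambda (fun ω m => ξ 0 m ω) fun m => hξ.meas 0 m) hξ.shift.measurable
    hξ.indepFun_shift hf
  exact h1.trans (lintegral_step_waitingTime (hξ.meas 0) (hξ.law 0) hrow R hN
    (F := fun s u => ∫⁻ ω, G s (t - u) (fun n m => ξ (n + 1) m ω) ∂P) fun s =>
      (hQ s).comp (measurable_const.sub measurable_id))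

/-- The state after `n` rings is independent of the event that exactly `n` rings have occurred up
to time `t`: its law is that of the discrete-time urn, while the event has the negative binomial
probability `yuleProb`, because the total number of balls grows deterministically with the rings. -/
theorem lintegral_ringEvent_indicator [IsProbabilityMeasure P] {k : ℕ} (hk : 0 < k)
    (hR : Balanced R k) {g : ℤ × ℤ → ℝ} (hg : ∀ s, 0 ≤ g s) (n : ℕ) (hξ : IsClocks ξ P)
    {s : ℤ × ℤ} (hs : Tenable R s) {t : ℝ} (ht : 0 ≤ t) :
    ∫⁻ ω, (ringEvent R s n t).indicator (fun x => ENNReal.ofReal (g (urn R s x n)))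
      (fun n m => ξ n m ω) ∂P =
    ENNReal.ofReal ((transition R)^[n] g s * yuleProb k ((s.1 + s.2 : ℝ) / k) t n) := by
  obtain ⟨w, β⟩ := s
  lift w to ℕ using hs.white_nonneg
  lift β to ℕ using hs.blue_nonneg
  have hN : 0 < w + β := by have := hs.total_pos; simp only at this; omega
  have hNR : (0 : ℝ) < w + β := by exact_mod_cast hN
  have hkR : (0 : ℝ) < k := by exact_mod_cast hk
  have hrow := fun n => hξ.indep.precomp (g := fun m : ℕ => (n, m)) fun p q hpq => by simpa using hpq
  induction n generalizing ξ w β t with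
  | zero =>
    have h1 := lintegral_step_waitingTime (hξ.meas 0) (hξ.law 0) (hrow 0) R hN
      (F := fun _ u => (Set.Ioi t).indicator (fun _ => ENNReal.ofReal (g (w, β))) u)
      (fun _ => measurable_const.indicator measurableSet_Ioi)
    have h2 : ∀ x : ℕ → ℕ → ℝ, (ringEvent R (w, β) 0 t).indicator
        (fun x => ENNReal.ofReal (g (urn R (w, β) x 0))) x =
        (Set.Ioi t).indicator (fun _ => ENNReal.ofReal (g (w, β))) (waitingTime (w, β) (x 0)) := by
      intro x
      simp [Set.indicator_apply, ringEvent, ringTime, urn, ht]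
    simp only [h2]
    rw [h1]
    have h3 : ∀ u, ENNReal.ofReal (Real.exp (-((w + β : ℝ) * u))) *
        (w * (Set.Ioi t).indicator (fun _ => ENNReal.ofReal (g (w, β))) u +
          β * (Set.Ioi t).indicator (fun _ => ENNReal.ofReal (g (w, β))) u) =
        (Set.Ioi t).indicator (fun u => ENNReal.ofReal ((w + β) * g (w, β) *
          Real.exp (-((w + β : ℝ) * u)))) u := by
      intro u
      by_cases hu : u ∈ Set.Ioi t
      · simp only [Set.indicator_of_mem hu]
        rw [← add_mul, ENNReal.ofReal_mul (mul_nonneg hNR.le (hg _)), ENNReal.ofReal_mul hNR.le,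
          ENNReal.ofReal_add (by positivity) (by positivity), ENNReal.ofReal_natCast,
          ENNReal.ofReal_natCast, mul_comm]
      · simp only [Set.indicator_of_notMem hu, mul_zero, add_zero]
    simp only [h3]
    rw [setLIntegral_indicator measurableSet_Ioi, Set.Ioi_inter_Ioi, max_eq_left ht,
      ← ofReal_integral_eq_lintegral_ofReal]
    · have h4 := integral_exp_mul_Ioi (neg_lt_zero.2 hNR) t
      simp only [neg_mul] at h4
      rw [integral_const_mul, h4, yuleProb_zero]
      congr 1
      simp only [Function.iterate_zero, id_eq, Int.cast_natCast]
      rw [mul_div_cancel₀ _ hkR.ne']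
      field_simp
    · have := exp_neg_integrableOn_Ioi t hNR
      simp only [neg_mul] at this
      exact Integrable.const_mul this _
    · exact ae_of_all _ fun u => mul_nonneg (mul_nonneg hNR.le (hg _)) (Real.exp_pos _).le
  | succ n ih =>
    set G : ℤ × ℤ → ℝ → (ℕ → ℕ → ℝ) → ENNReal := fun s' v =>
      (ringEvent R s' n v).indicator (fun x => ENNReal.ofReal (g (urn R s' x n))) with hG
    have hGm : ∀ s', Measurable fun p : ℝ × (ℕ → ℕ → ℝ) => G s' p.1 p.2 := by
      intro s'
      have h1 : Measurable ({p : ℝ × (ℕ → ℕ → ℝ) | p.2 ∈ ringEvent R s' n p.1}.indicator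
          fun p => ENNReal.ofReal (g (urn R s' p.2 n))) := by
        refine Measurable.indicator ?_ (measurableSet_ringEvent_prod s' n)
        exact (measurable_of_countable g).comp ((measurable_urn R s' n).comp
          measurable_snd) |>.ennreal_ofReal
      convert! h1 using 2
    have h1 : ∀ x : ℕ → ℕ → ℝ, (ringEvent R (w, β) (n + 1) t).indicator
        (fun x => ENNReal.ofReal (g (urn R (w, β) x (n + 1)))) x =
        G (step R (w, β) (x 0)) (t - waitingTime (w, β) (x 0)) (fun l => x (l + 1)) := by
      intro x
      simp only [hG]
      by_cases h : x ∈ ringEvent R (w, β) (n + 1) t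
      · rw [Set.indicator_of_mem h, Set.indicator_of_mem ((mem_ringEvent_succ _ _ _ _).1 h),
          urn_succ_eq]
      · rw [Set.indicator_of_notMem h,
          Set.indicator_of_notMem (mt (mem_ringEvent_succ _ _ _ _).2 h)]
    simp only [h1]
    set Q : ℤ × ℤ → ℝ → ENNReal := fun s' v => ∫⁻ ω, G s' v (fun n m => ξ (n + 1) m ω) ∂P with hQ
    rw [lintegral_first_step hξ hN hGm t]
    -- no ring occurs before time `0`, and at nonnegative times the induction hypothesis applies
    have hQneg : ∀ s' v, v < 0 → Q s' v = 0 := by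
      intro s' v hv
      refine (lintegral_congr_ae ?_).trans lintegral_zero
      filter_upwards [hξ.shift.ae_nonneg] with ω hω
      refine Set.indicator_of_notMem (fun h => ?_) _
      exact absurd (h.1.trans_lt hv) (not_lt.2 (ringTime_nonneg hω s' n))
    set r : ℝ := (w + β) / k with hr
    have hr0 : 0 < r := by positivity
    have hkr : k * r = w + β := by rw [hr]; field_simp
    have hQpos : ∀ s', Tenable R s' → s'.1 + s'.2 = (w : ℤ) + β + k → ∀ v, 0 ≤ v →
        Q s' v = ENNReal.ofReal ((transition R)^[n] g s' * yuleProb k (r + 1) v n) := by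
      rintro ⟨w', β'⟩ h4 h5 v hv
      lift w' to ℕ using h4.white_nonneg
      lift β' to ℕ using h4.blue_nonneg
      have h6 : (w' : ℝ) + β' = w + β + k := by simp only at h5; exact_mod_cast h5
      have := ih hξ.shift hv w' β' h4 (by have := h4.total_pos; simp only at this; omega)
        (by rw [h6]; positivity) (fun n => hrow (n + 1))
      simp only [Int.cast_natCast] at this
      rw [h6, add_div _ (k : ℝ), div_self hkR.ne'] at this
      exact this
    set K := (transition R)^[n + 1] g ((w : ℤ), (β : ℤ)) with hK
    have hKnn : 0 ≤ K := transition_iterate_nonneg hR _ hs fun _ _ => hg _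
    have hKeq : (w : ℝ) * (transition R)^[n] g (pickWhite R (w, β)) +
        β * (transition R)^[n] g (pickBlue R (w, β)) = (w + β) * K := by
      rw [hK, Function.iterate_succ_apply', transition]
      simp only [Int.cast_natCast]
      field_simp
    have h4 : ∀ u ∈ Set.Ioi (0 : ℝ), ENNReal.ofReal (Real.exp (-((w + β : ℝ) * u))) *
        (w * Q (pickWhite R (w, β)) (t - u) + β * Q (pickBlue R (w, β)) (t - u)) =
        (Set.Iic t).indicator (fun u => ENNReal.ofReal (K * (k * r * Real.exp (-(k * r * u)) *
          yuleProb k (r + 1) (t - u) n))) u := by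
      intro u hu
      by_cases hut : u ≤ t
      · rw [Set.indicator_of_mem (Set.mem_Iic.2 hut)]
        have hv : 0 ≤ t - u := sub_nonneg.2 hut
        have hy := yuleProb_nonneg hkR (add_pos hr0 one_pos) hv n
        have hW : (w : ENNReal) * Q (pickWhite R (w, β)) (t - u) =
            ENNReal.ofReal (w * ((transition R)^[n] g (pickWhite R (w, β))) *
              yuleProb k (r + 1) (t - u) n) ∧
            0 ≤ (w : ℝ) * (transition R)^[n] g (pickWhite R (w, β)) := by
          rcases Nat.eq_zero_or_pos w with h0 | h0
          · simp [h0]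
          · have hT : Tenable R (pickWhite R (w, β)) := hs.white (Int.natCast_pos.2 h0)
            rw [hQpos _ hT (hR.pickWhite_total _) _ hv, ← ENNReal.ofReal_natCast,
              ← ENNReal.ofReal_mul (Nat.cast_nonneg w), mul_assoc]
            exact ⟨rfl, mul_nonneg (Nat.cast_nonneg w)
              (transition_iterate_nonneg hR _ hT fun _ _ => hg _)⟩
        have hB : (β : ENNReal) * Q (pickBlue R (w, β)) (t - u) =
            ENNReal.ofReal (β * ((transition R)^[n] g (pickBlue R (w, β))) *
              yuleProb k (r + 1) (t - u) n) ∧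
            0 ≤ (β : ℝ) * (transition R)^[n] g (pickBlue R (w, β)) := by
          rcases Nat.eq_zero_or_pos β with h0 | h0
          · simp [h0]
          · have hT : Tenable R (pickBlue R (w, β)) := hs.blue (Int.natCast_pos.2 h0)
            rw [hQpos _ hT (hR.pickBlue_total _) _ hv, ← ENNReal.ofReal_natCast,
              ← ENNReal.ofReal_mul (Nat.cast_nonneg β), mul_assoc]
            exact ⟨rfl, mul_nonneg (Nat.cast_nonneg β)
              (transition_iterate_nonneg hR _ hT fun _ _ => hg _)⟩
        rw [hW.1, hB.1, ← ENNReal.ofReal_add (mul_nonneg hW.2 hy) (mul_nonneg hB.2 hy),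
          ← ENNReal.ofReal_mul (Real.exp_pos _).le, ← add_mul, hKeq, hkr]
        congr 1
        ring
      · rw [Set.indicator_of_notMem (by simpa using hut), hQneg _ _ (by linarith),
          hQneg _ _ (by linarith)]
        simp
    rw [setLIntegral_congr_fun measurableSet_Ioi h4, setLIntegral_indicator measurableSet_Iic,
      Set.inter_comm, Set.Ioi_inter_Iic, ← ofReal_integral_eq_lintegral_ofReal]
    · rw [← intervalIntegral.integral_of_le ht, intervalIntegral.integral_const_mul,
        intervalIntegral_yuleProb]
      simp only [Int.cast_natCast, hr]
    · rw [← IntegrableOn, ← intervalIntegrable_iff_integrableOn_Ioc_of_le ht]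
      exact Continuous.intervalIntegrable (by unfold yuleProb; fun_prop) _ _
    · refine (ae_restrict_iff' measurableSet_Ioc).2 (ae_of_all _ fun u hu => ?_)
      have := yuleProb_nonneg hkR (add_pos hr0 one_pos) (sub_nonneg.2 hu.2) n
      simp only [Pi.zero_apply]
      positivity

end FirstStep

/-! ### The urn at a fixed time -/

section RingCount

variable {R : Matrix (Fin 2) (Fin 2) ℤ} {s : ℤ × ℤ}

theorem ringCount_eq_of_mem {x : ℕ → ℕ → ℝ} (hx : ∀ n m, 0 ≤ x n m) {n : ℕ} {t : ℝ}
    (h : x ∈ ringEvent R s n t) : ringCount R s x t = n := by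
  refine IsGreatest.csSup_eq ⟨h.1, fun m hm => ?_⟩
  by_contra hlt
  have h1 := monotone_ringTime (R := R) hx s (show n + 1 ≤ m by omega)
  have h2 : ringTime R s x m ≤ t := hm
  linarith [h.2]

theorem Balanced.urn_total {k : ℕ} (hR : Balanced R k) (s : ℤ × ℤ) (x : ℕ → ℕ → ℝ) (n : ℕ) :
    (urn R s x n).1 + (urn R s x n).2 = s.1 + s.2 + k * n := by
  induction n with
  | zero => simp [urn]
  | succ n ih =>
    rw [urn, step]
    split_ifs
    · rw [hR.pickWhite_total, ih]; push_cast; ring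
    · rw [hR.pickBlue_total, ih]; push_cast; ring

/-- The minimum defining the waiting time is attained, so that a ball of the colour prescribed by
`step` is present. -/
theorem Tenable.reachable_step {s₀ : ℤ × ℤ} (hs₀ : Tenable R s₀) (hs : Reachable R s₀ s)
    (x : ℕ → ℝ) : Reachable R s₀ (step R s x) := by
  obtain ⟨h1, h2, h3⟩ := hs₀ s hs
  unfold step
  split_ifs with h
  · obtain ⟨m, hm, -⟩ := h
    exact hs.white (by omega)
  · refine hs.blue (lt_of_not_ge fun h4 => h ?_)
    have : Nonempty (Fin (s.1 + s.2).toNat) := ⟨⟨0, by omega⟩⟩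
    obtain ⟨m, hm⟩ := exists_eq_ciInf_of_finite (f := fun m : Fin (s.1 + s.2).toNat => x m)
    exact ⟨m, by have := m.2; omega, hm⟩

theorem Tenable.reachable_urn (hs : Tenable R s) (x : ℕ → ℕ → ℝ) (n : ℕ) :
    Reachable R s (urn R s x n) := by
  induction n with
  | zero => exact .start
  | succ n ih => exact hs.reachable_step ih _

/-- Both sides are `0` if the set is unbounded. -/
theorem sSup_eq_iSup_ite (p : ℕ → Prop) [DecidablePred p] :
    sSup {n | p n} = ⨆ n, if p n then n else 0 := by
  by_cases h : BddAbove {n | p n}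
  · have hb : BddAbove (Set.range fun n => if p n then n else 0) := by
      obtain ⟨M, hM⟩ := h
      refine ⟨M, ?_⟩
      rintro _ ⟨n, rfl⟩
      simp only
      split_ifs with hn
      · exact hM hn
      · exact Nat.zero_le _
    refine le_antisymm ?_ (ciSup_le fun n => ?_)
    · rcases Set.eq_empty_or_nonempty {n | p n} with h0 | h0
      · rw [h0]; simp
      · refine csSup_le h0 fun n hn => ?_
        have := le_ciSup hb n
        rwa [if_pos (show p n from hn)] at this
    · split_ifs with hn
      · exact le_csSup h hn
      · exact Nat.zero_le _
  · have hb : ¬ BddAbove (Set.range fun n => if p n then n else 0) := by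
      rintro ⟨M, hM⟩
      refine h ⟨M, fun n hn => ?_⟩
      have := hM ⟨n, rfl⟩
      simp only at this
      rwa [if_pos (show p n from hn)] at this
    rw [Nat.sSup_of_not_bddAbove h, iSup, Nat.sSup_of_not_bddAbove hb]

theorem measurable_ringCount (R : Matrix (Fin 2) (Fin 2) ℤ) (s : ℤ × ℤ) (t : ℝ) :
    Measurable fun x => ringCount R s x t := by
  classical
  unfold ringCount
  simp only [sSup_eq_iSup_ite]
  exact Measurable.iSup fun n => Measurable.ite
    (measurableSet_le (measurable_ringTime R s n) measurable_const) measurable_const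
    measurable_const

theorem measurable_urn_ringCount (R : Matrix (Fin 2) (Fin 2) ℤ) (s : ℤ × ℤ) (t : ℝ) :
    Measurable fun x => urn R s x (ringCount R s x t) := by
  have h : Measurable fun p : ℕ × (ℕ → ℕ → ℝ) => urn R s p.2 p.1 :=
    measurable_from_prod_countable_right fun n => measurable_urn R s n
  exact h.comp (f := fun x : ℕ → ℕ → ℝ => (ringCount R s x t, x))
    ((measurable_ringCount R s t).prodMk measurable_id)

end RingCount

section Expectation

variable {Ω : Type*} [MeasurableSpace Ω] {P : Measure Ω} [IsProbabilityMeasure P]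
  {ξ : ℕ → ℕ → Ω → ℝ} {R : Matrix (Fin 2) (Fin 2) ℤ} {k : ℕ} {s : ℤ × ℤ}

theorem measure_ringEvent (hk : 0 < k) (hR : Balanced R k) (hξ : IsClocks ξ P) (hs : Tenable R s)
    {t : ℝ} (ht : 0 ≤ t) (n : ℕ) :
    P ((fun ω n m => ξ n m ω) ⁻¹' ringEvent R s n t) =
      ENNReal.ofReal (yuleProb k ((s.1 + s.2 : ℝ) / k) t n) := by
  have h := lintegral_ringEvent_indicator hk hR (g := fun _ => 1) (fun _ => zero_le_one) n hξ hs ht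
  have h1 := transition_iterate_affine n hs (fun _ => 0) 1 0
  simp only [mul_zero, add_zero, zero_mul] at h1
  rw [h1, one_mul] at h
  rw [← h, ← lintegral_indicator_one (hξ.measurable (measurableSet_ringEvent s n t))]
  refine lintegral_congr fun ω => ?_
  rw [ENNReal.ofReal_one]
  rfl

theorem div_natCast_total_pos (hk : 0 < k) (hs : Tenable R s) : (0 : ℝ) < (s.1 + s.2 : ℝ) / k :=
  div_pos (by exact_mod_cast hs.total_pos) (by exact_mod_cast hk)

/-- The process does not explode: almost surely only finitely many rings occur up to time `t`,
because the probabilities of the events `ringEvent R s n t` sum to one. -/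
theorem ae_exists_mem_ringEvent (hk : 0 < k) (hR : Balanced R k) (hξ : IsClocks ξ P)
    (hs : Tenable R s) {t : ℝ} (ht : 0 ≤ t) :
    ∀ᵐ ω ∂P, ∃ n, (fun n m => ξ n m ω) ∈ ringEvent R s n t := by
  set E : ℕ → Set Ω := fun n => (fun ω n m => ξ n m ω) ⁻¹' ringEvent R s n t with hE
  have hEm : ∀ n, MeasurableSet (E n) := fun n => hξ.measurable (measurableSet_ringEvent s n t)
  have hd : Pairwise (Function.onFun (AEDisjoint P) E) := by
    intro i j hij
    refine measure_mono_null ?_ (ae_iff.1 hξ.ae_nonneg)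
    rintro ω ⟨h1, h2⟩ h3
    exact hij ((ringCount_eq_of_mem h3 h1).symm.trans (ringCount_eq_of_mem h3 h2))
  have h := measure_iUnion₀ hd fun n => (hEm n).nullMeasurableSet
  have hkR : (0 : ℝ) < k := by exact_mod_cast hk
  have hr := div_natCast_total_pos hk hs
  have hsum := hasSum_yuleProb hkR hr ht
  simp only [hE, measure_ringEvent hk hR hξ hs ht] at h
  rw [← ENNReal.ofReal_tsum_of_nonneg (yuleProb_nonneg hkR hr ht) hsum.summable, hsum.tsum_eq,
    ENNReal.ofReal_one] at h
  have h2 := (prob_compl_eq_zero_iff (MeasurableSet.iUnion hEm)).2 h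
  filter_upwards [compl_mem_ae_iff.2 h2] with ω hω
  simpa [hE] using hω

theorem lintegral_urn_ringCount (hk : 0 < k) (hR : Balanced R k) (hξ : IsClocks ξ P)
    (hs : Tenable R s) {g : ℤ × ℤ → ℝ} (hg : ∀ s, 0 ≤ g s) {t : ℝ} (ht : 0 ≤ t) :
    ∫⁻ ω, ENNReal.ofReal (g (urn R s (fun n m => ξ n m ω) (ringCount R s (fun n m => ξ n m ω) t))) ∂P
      = ∑' n, ENNReal.ofReal (yuleProb k ((s.1 + s.2 : ℝ) / k) t n * (transition R)^[n] g s) := by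
  have h : ∀ᵐ ω ∂P, ENNReal.ofReal (g (urn R s (fun n m => ξ n m ω)
      (ringCount R s (fun n m => ξ n m ω) t))) = ∑' n, (ringEvent R s n t).indicator
        (fun x => ENNReal.ofReal (g (urn R s x n))) (fun n m => ξ n m ω) := by
    filter_upwards [ae_exists_mem_ringEvent hk hR hξ hs ht, hξ.ae_nonneg] with ω ⟨n, hn⟩ h0
    rw [tsum_eq_single n, Set.indicator_of_mem hn, ringCount_eq_of_mem h0 hn]
    intro j hj
    refine Set.indicator_of_notMem (fun hj' => hj ?_) _
    exact (ringCount_eq_of_mem h0 hj').symm.trans (ringCount_eq_of_mem h0 hn)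
  rw [lintegral_congr_ae h, lintegral_tsum]
  · refine tsum_congr fun n => ?_
    rw [lintegral_ringEvent_indicator hk hR hg n hξ hs ht, mul_comm]
  · intro n
    have h1 : Measurable fun x => ENNReal.ofReal (g (urn R s x n)) :=
      ((measurable_of_countable g).comp (measurable_urn R s n)).ennreal_ofReal
    exact ((h1.indicator (measurableSet_ringEvent s n t)).comp hξ.measurable).aemeasurable

/-- Growth of expectations in continuous time: if the expectations of `g` along the discrete-time
urn are asymptotic to `L` times the `p`-th power of the number of balls, then in continuous time
they are asymptotic to `L * exp (k p t)` times the `p`-th moment of the gamma limit. -/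
theorem integrable_and_tendsto_integral_urn_ringCount (hk : 0 < k) (hR : Balanced R k)
    (hξ : IsClocks ξ P) (hs : Tenable R s) {g : ℤ × ℤ → ℝ} (hg : ∀ s, 0 ≤ g s) {L : ℝ} (p : ℕ)
    (hL : Tendsto (fun n : ℕ => (transition R)^[n] g s / (s.1 + s.2 + k * n : ℝ) ^ p) atTop (𝓝 L)) :
    (∀ t, 0 ≤ t → Integrable (fun ω => g (urn R s (fun n m => ξ n m ω)
      (ringCount R s (fun n m => ξ n m ω) t))) P) ∧
    Tendsto (fun t => (∫ ω, g (urn R s (fun n m => ξ n m ω)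
      (ringCount R s (fun n m => ξ n m ω) t)) ∂P) / Real.exp (k * p * t)) atTop
      (𝓝 (L * k ^ p * (ascPochhammer ℝ p).eval ((s.1 + s.2 : ℝ) / k))) := by
  have hkR : (0 : ℝ) < k := by exact_mod_cast hk
  set r : ℝ := (s.1 + s.2 : ℝ) / k with hr
  have hr0 : 0 < r := div_natCast_total_pos hk hs
  have hL' : Tendsto (fun n : ℕ => (transition R)^[n] g s / (k * (r + n)) ^ p) atTop (𝓝 L) := by
    refine hL.congr fun n => ?_
    congr 2
    rw [hr]
    field_simp
  obtain ⟨hsum, hlim⟩ := tendsto_tsum_yuleProb_mul_div_exp hkR hr0 p hL'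
  have hnn : ∀ t, 0 ≤ t → ∀ n, 0 ≤ yuleProb k r t n * (transition R)^[n] g s := fun t ht n =>
    mul_nonneg (yuleProb_nonneg hkR hr0 ht n)
      (transition_iterate_nonneg hR n hs fun _ _ => hg _)
  have hlint : ∀ t, 0 ≤ t → ∫⁻ ω, ENNReal.ofReal (g (urn R s (fun n m => ξ n m ω)
      (ringCount R s (fun n m => ξ n m ω) t))) ∂P =
      ENNReal.ofReal (∑' n, yuleProb k r t n * (transition R)^[n] g s) := fun t ht => by
    rw [lintegral_urn_ringCount hk hR hξ hs hg ht,
      ENNReal.ofReal_tsum_of_nonneg (hnn t ht) (hsum t ht)]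
  have hmeas : ∀ t, AEStronglyMeasurable (fun ω => g (urn R s (fun n m => ξ n m ω)
      (ringCount R s (fun n m => ξ n m ω) t))) P := fun t =>
    ((measurable_of_countable g).comp
      ((measurable_urn_ringCount R s t).comp hξ.measurable)).aestronglyMeasurable
  constructor
  · intro t ht
    refine ⟨hmeas t, ?_⟩
    rw [hasFiniteIntegral_iff_ofReal (ae_of_all _ fun _ => hg _), hlint t ht]
    exact ENNReal.ofReal_lt_top
  · refine hlim.congr' ?_
    filter_upwards [eventually_ge_atTop 0] with t ht
    rw [integral_eq_lintegral_of_nonneg_ae (ae_of_all _ fun _ => hg _) (hmeas t), hlint t ht,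
      ENNReal.toReal_ofReal (tsum_nonneg (hnn t ht))]

/-- The characteristic function of the rescaled number of balls. -/
theorem charFun_map_total (hk : 0 < k) (hR : Balanced R k) (hξ : IsClocks ξ P) (hs : Tenable R s)
    {t : ℝ} (ht : 0 ≤ t) (y z : ℝ) :
    charFun (P.map fun ω => y * (s.1 + s.2 + k * ringCount R s (fun n m => ξ n m ω) t : ℝ)) z =
      ∑' n : ℕ, (yuleProb k ((s.1 + s.2 : ℝ) / k) t n : ℂ) *
        Complex.exp ((z * (y * (k * ((s.1 + s.2 : ℝ) / k + n))) : ℝ) * Complex.I) := by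
  have hkR : (0 : ℝ) < k := by exact_mod_cast hk
  have hr0 := div_natCast_total_pos hk hs
  have hN : Measurable fun ω => ringCount R s (fun n m => ξ n m ω) t :=
    (measurable_ringCount R s t).comp hξ.measurable
  have := Measure.isProbabilityMeasure_map (μ := P) hN.aemeasurable
  set f : ℕ → ℂ := fun n => Complex.exp ((z * (y * (k * ((s.1 + s.2 : ℝ) / k + n))) : ℝ) * Complex.I)
  have h1 : ∀ n : ℕ, Complex.exp (z * (y * (s.1 + s.2 + k * n : ℝ) : ℝ) * Complex.I) = f n := by
    intro n
    simp only [f]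
    rw [← Complex.ofReal_mul]
    congr 4
    field_simp
  have hlaw : ∀ n, (P.map fun ω => ringCount R s (fun n m => ξ n m ω) t).real {n} =
      yuleProb k ((s.1 + s.2 : ℝ) / k) t n := by
    intro n
    rw [measureReal_def, Measure.map_apply hN (measurableSet_singleton n)]
    have h2 : (fun ω => ringCount R s (fun n m => ξ n m ω) t) ⁻¹' {n} =ᵐ[P]
        (fun ω n m => ξ n m ω) ⁻¹' ringEvent R s n t := by
      filter_upwards [ae_exists_mem_ringEvent hk hR hξ hs ht, hξ.ae_nonneg] with ω ⟨j, hj⟩ h0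
      refine propext ⟨fun h3 => ?_, fun h3 => ringCount_eq_of_mem h0 h3⟩
      have h4 : j = n := (ringCount_eq_of_mem h0 hj).symm.trans h3
      exact h4 ▸ hj
    rw [measure_congr h2, measure_ringEvent hk hR hξ hs ht,
      ENNReal.toReal_ofReal (yuleProb_nonneg hkR hr0 ht n)]
  have hm : AEMeasurable (fun ω => y * (s.1 + s.2 + k *
      ringCount R s (fun n m => ξ n m ω) t : ℝ)) P :=
    ((measurable_of_countable fun n : ℕ => y * (s.1 + s.2 + k * n : ℝ)).comp hN).aemeasurable
  rw [charFun_apply_real, integral_map hm (by fun_prop)]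
  simp only [h1]
  rw [← integral_map (f := f) hN.aemeasurable (measurable_of_countable f).aestronglyMeasurable,
    integral_countable]
  · simp only [hlaw, Complex.real_smul, f]
  · refine Integrable.of_bound (measurable_of_countable f).aestronglyMeasurable 1
      (ae_of_all _ fun n => ?_)
    exact (Complex.norm_exp_ofReal_mul_I _).le

/-- The rescaled number of balls converges in distribution to a gamma law. -/
theorem tendstoInDistribution_total (hk : 0 < k) (hR : Balanced R k) (hξ : IsClocks ξ P)
    (hs : Tenable R s) {Ω' : Type*} [MeasurableSpace Ω'] {P' : Measure Ω'} [IsProbabilityMeasure P']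
    {G : Ω' → ℝ} (hG : HasLaw G (gammaMeasure ((s.1 + s.2 : ℝ) / k) (1 / (k : ℝ))) P') :
    TendstoInDistribution (fun (t : ℝ) ω => Real.exp (-(k * t)) *
      (s.1 + s.2 + k * ringCount R s (fun n m => ξ n m ω) t : ℝ)) atTop G (fun _ => P) P' := by
  have hkR : (0 : ℝ) < k := by exact_mod_cast hk
  refine ⟨fun t => ?_, hG.aemeasurable, ?_⟩
  · have hN : Measurable fun ω => ringCount R s (fun n m => ξ n m ω) t :=
      (measurable_ringCount R s t).comp hξ.measurable
    exact ((measurable_of_countable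
      fun n : ℕ => Real.exp (-(k * t)) * (s.1 + s.2 + k * n : ℝ)).comp hN).aemeasurable
  · refine tendsto_of_seq_tendsto fun u hu => ?_
    refine ProbabilityMeasure.tendsto_iff_tendsto_charFun.2 fun z => ?_
    have h := (tendsto_tsum_yuleProb_mul_cexp hkR (div_natCast_total_pos hk hs) z).comp hu
    simp only [ProbabilityMeasure.coe_mk, hG.map_eq]
    refine h.congr' ?_
    filter_upwards [hu.eventually_ge_atTop 0] with n hn
    exact (charFun_map_total hk hR hξ hs hn _ z).symm

end Expectation

end PolyaUrn

theorem theorem1 {Ω : Type*} [MeasurableSpace Ω] (P : Measure Ω) [IsProbabilityMeasure P]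
    -- the independent clocks, each of which rings in time `Exp(1)`
    (ξ : ℕ → ℕ → Ω → ℝ)
    (hξ_meas : ∀ n m, Measurable (ξ n m))
    (hξ_law : ∀ n m, HasLaw (ξ n m) (expMeasure 1) P)
    (hξ_indep : iIndepFun (fun p : ℕ × ℕ => ξ p.1 p.2) P)
    -- the Bagchi-Pal urn and its initial state
    (k b c W₀ B₀ : ℕ) (hk : 0 < k) (hbc : 0 < b + c)
    (hten : PolyaUrn.Tenable (PolyaUrn.bagchiPal k b c) ((W₀ : ℤ), (B₀ : ℤ)))
    -- the numbers of white and blue balls at time `t`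
    (W B : ℝ → Ω → ℝ)
    (hW : ∀ t ω, W t ω =
      (PolyaUrn.white (PolyaUrn.bagchiPal k b c) ((W₀ : ℤ), (B₀ : ℤ)) (fun n m => ξ n m ω) t : ℝ))
    (hB : ∀ t ω, B t ω =
      (PolyaUrn.blue (PolyaUrn.bagchiPal k b c) ((W₀ : ℤ), (B₀ : ℤ)) (fun n m => ξ n m ω) t : ℝ))
    -- a random variable with the gamma law of shape `τ₀ / k` and scale `k` (that is, rate `1 / k`)
    {Ω' : Type*} [MeasurableSpace Ω'] (P' : Measure Ω') [IsProbabilityMeasure P'] (G : Ω' → ℝ)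
    (hG : HasLaw G (gammaMeasure (((W₀ : ℝ) + B₀) / k) (1 / (k : ℝ))) P') :
    (∀ i j : ℕ,
      (∀ t : ℝ, 0 ≤ t → Integrable (fun ω => W t ω ^ i * B t ω ^ j) P) ∧
      Tendsto (fun t : ℝ => (∫ ω, W t ω ^ i * B t ω ^ j ∂P) / Real.exp ((k : ℝ) * ((i : ℝ) + j) * t))
        atTop
        (𝓝 ((b : ℝ) ^ j * (c : ℝ) ^ i / ((b : ℝ) + c) ^ (i + j) * (k : ℝ) ^ (i + j) *
          (ascPochhammer ℝ (i + j)).eval (((W₀ : ℝ) + B₀) / k)))) ∧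
    TendstoInDistribution
      (fun (t : ℝ) ω => (Real.exp (-((k : ℝ) * t)) * W t ω, Real.exp (-((k : ℝ) * t)) * B t ω))
      atTop
      (fun ω' => (G ω' * ((c : ℝ) / ((b : ℝ) + c)), G ω' * ((b : ℝ) / ((b : ℝ) + c))))
      (fun _ => P) P' := by
  have hξ : PolyaUrn.IsClocks ξ P := ⟨hξ_meas, hξ_law, hξ_indep⟩
  have hR := PolyaUrn.balanced_bagchiPal k b c
  have hbcR : (0 : ℝ) < b + c := by exact_mod_cast hbc
  set R := PolyaUrn.bagchiPal k b c
  set S : ℝ → Ω → ℤ × ℤ := fun t ω => PolyaUrn.urn R ((W₀ : ℤ), (B₀ : ℤ)) (fun n m => ξ n m ω)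
    (PolyaUrn.ringCount R ((W₀ : ℤ), (B₀ : ℤ)) (fun n m => ξ n m ω) t) with hS
  have hWS : ∀ t ω, W t ω = ((S t ω).1 : ℝ) := hW
  have hBS : ∀ t ω, B t ω = ((S t ω).2 : ℝ) := hB
  have hSm : ∀ t, Measurable (S t) := fun t =>
    (PolyaUrn.measurable_urn_ringCount R _ t).comp hξ.measurable
  have hWm : ∀ t, Measurable (W t) := fun t => by
    rw [show W t = fun ω => ((S t ω).1 : ℝ) from funext (hWS t)]
    exact (measurable_of_countable fun s : ℤ × ℤ => (s.1 : ℝ)).comp (hSm t)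
  have hBm : ∀ t, Measurable (B t) := fun t => by
    rw [show B t = fun ω => ((S t ω).2 : ℝ) from funext (hBS t)]
    exact (measurable_of_countable fun s : ℤ × ℤ => (s.2 : ℝ)).comp (hSm t)
  refine ⟨fun i j => ?_, ?_⟩
  · obtain ⟨h1, h2⟩ := PolyaUrn.integrable_and_tendsto_integral_urn_ringCount hk hR hξ hten
      (g := fun s' => |(s'.1 : ℝ) ^ i * (s'.2 : ℝ) ^ j|) (fun _ => abs_nonneg _) (i + j)
      (PolyaUrn.tendsto_transition_iterate_monomial hk hbc hten i j)
    have h3 : ∀ t ω, |((S t ω).1 : ℝ) ^ i * ((S t ω).2 : ℝ) ^ j| = W t ω ^ i * B t ω ^ j := by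
      intro t ω
      obtain ⟨h4, h5, -⟩ := hten _ (hten.reachable_urn (fun n m => ξ n m ω)
        (PolyaUrn.ringCount R ((W₀ : ℤ), (B₀ : ℤ)) (fun n m => ξ n m ω) t))
      rw [hWS, hBS]
      exact abs_of_nonneg (mul_nonneg (pow_nonneg (by exact_mod_cast h4) _)
        (pow_nonneg (by exact_mod_cast h5) _))
    have h6 : ∀ t, (fun ω => |((S t ω).1 : ℝ) ^ i * ((S t ω).2 : ℝ) ^ j|) =
        fun ω => W t ω ^ i * B t ω ^ j := fun t => funext (h3 t)
    simp only [hS] at h6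
    simp only [h6] at h1 h2
    refine ⟨h1, ?_⟩
    simpa using h2
  · have hX := (PolyaUrn.tendstoInDistribution_total hk hR hξ hten (G := G) (P' := P')
      (by simpa using hG)).continuous_comp (g := fun y : ℝ =>
        (y * ((c : ℝ) / (b + c)), y * ((b : ℝ) / (b + c)))) (by fun_prop)
    -- the deviation from the direction `(c, b)` is the rescaled imbalance, which vanishes in `L²`
    obtain ⟨h1, h2⟩ := PolyaUrn.integrable_and_tendsto_integral_urn_ringCount hk hR hξ hten
      (g := fun s' => PolyaUrn.imbalance b c s' ^ 2) (fun _ => sq_nonneg _) 2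
      (PolyaUrn.tendsto_transition_iterate_imbalance_sq hk hbc hten)
    simp only [zero_mul] at h2
    refine tendstoInDistribution_of_tendstoInMeasure_sub _ _ hX ?_ fun t =>
      ((hWm t).const_mul _ |>.prodMk ((hBm t).const_mul _)).aemeasurable
    rw [tendstoInMeasure_iff_norm]
    intro ε hε
    have hnorm : ∀ t ω, ‖(Real.exp (-(k * t)) * W t ω, Real.exp (-(k * t)) * B t ω) -
        ((fun y : ℝ => (y * ((c : ℝ) / (b + c)), y * ((b : ℝ) / (b + c)))) ∘ fun ω =>
          Real.exp (-(k * t)) * (((W₀ : ℤ) : ℝ) + ((B₀ : ℤ) : ℝ) + k * PolyaUrn.ringCount R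
            ((W₀ : ℤ), (B₀ : ℤ)) (fun n m => ξ n m ω) t)) ω‖ =
        Real.exp (-(k * t)) * |PolyaUrn.imbalance b c (S t ω)| / (b + c) := by
      intro t ω
      have h3 : (((W₀ : ℤ) : ℝ) + ((B₀ : ℤ) : ℝ) + k * PolyaUrn.ringCount R
            ((W₀ : ℤ), (B₀ : ℤ)) (fun n m => ξ n m ω) t) = (S t ω).1 + (S t ω).2 := by
        exact_mod_cast (hR.urn_total ((W₀ : ℤ), (B₀ : ℤ)) (fun n m => ξ n m ω) _).symm
      have h4 : Real.exp (-(k * t)) * ((S t ω).1 : ℝ) -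
          Real.exp (-(k * t)) * ((S t ω).1 + (S t ω).2) * (c / (b + c)) =
          Real.exp (-(k * t)) * PolyaUrn.imbalance b c (S t ω) / (b + c) := by
        rw [PolyaUrn.imbalance]; field_simp; ring
      have h5 : Real.exp (-(k * t)) * ((S t ω).2 : ℝ) -
          Real.exp (-(k * t)) * ((S t ω).1 + (S t ω).2) * (b / (b + c)) =
          -(Real.exp (-(k * t)) * PolyaUrn.imbalance b c (S t ω) / (b + c)) := by
        rw [PolyaUrn.imbalance]; field_simp; ring
      simp only [Function.comp_apply]
      rw [h3, hWS, hBS, Prod.mk_sub_mk, h4, h5, Prod.norm_mk, norm_neg, max_self, norm_div, norm_mul,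
        Real.norm_of_nonneg (Real.exp_pos _).le, Real.norm_of_nonneg hbcR.le, Real.norm_eq_abs]
    set δ : ℝ := (ε * (b + c)) ^ 2
    have hδ : 0 < δ := by positivity
    have hlim : Tendsto (fun t => ENNReal.ofReal ((∫ ω, PolyaUrn.imbalance b c (S t ω) ^ 2 ∂P) /
        Real.exp (k * (2 : ℕ) * t) / δ)) atTop (𝓝 0) := by
      have := ENNReal.tendsto_ofReal (h2.div_const δ)
      simpa only [zero_div, ENNReal.ofReal_zero] using this
    refine tendsto_of_tendsto_of_tendsto_of_le_of_le' tendsto_const_nhds hlim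
      (Eventually.of_forall fun _ => zero_le) ?_
    filter_upwards [eventually_ge_atTop 0] with t ht
    have hM := mul_meas_ge_le_integral_of_nonneg (ae_of_all P fun ω => sq_nonneg
      (PolyaUrn.imbalance b c (S t ω))) (h1 t ht) (δ * Real.exp (k * (2 : ℕ) * t))
    rw [← ENNReal.ofReal_toReal (measure_ne_top P _)]
    refine ENNReal.ofReal_le_ofReal ?_
    rw [div_div, le_div_iff₀' (mul_pos (Real.exp_pos _) hδ), mul_comm (Real.exp _)]
    refine le_trans (mul_le_mul_of_nonneg_left (measureReal_mono fun ω hω => ?_) (by positivity)) hM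
    have hω' : ε ≤ Real.exp (-(k * t)) * |PolyaUrn.imbalance b c (S t ω)| / (b + c) := by
      rw [← hnorm]
      simpa using hω
    rw [le_div_iff₀ hbcR, Real.exp_neg, inv_mul_eq_div, le_div_iff₀ (Real.exp_pos _)] at hω'
    have h6 : δ * Real.exp (k * (2 : ℕ) * t) = (ε * (b + c) * Real.exp (k * t)) ^ 2 := by
      rw [mul_pow, ← Real.exp_nat_mul]
      congr 2
      push_cast
      ring
    simp only [Set.mem_ofPred_eq]
    rw [h6, ← sq_abs (PolyaUrn.imbalance b c (S t ω))]
    gcongr
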